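/- Let $n\ge 1$ and realise $\mathbb{CP}^{2n+1}=\mathrm{Sp}(n+1)/H$, $H=\mathrm U(1)\times\mathrm{Sp}(n)$ (upper left $1\times1$ block, lower right $n\times n$ block), with $\mathfrak m=\mathfrak h^{\perp}=\mathcal V\oplus\mathcal H$, where $\mathcal V$ is the part in the upper left entry, and with an invariant metric $g_{a,t}=aB_0|_{\mathcal H}+2at\,B_0|_{\mathcal V}$, $a,t>0$, $B_0(X,Y)=-\mathrm{Re}\,\mathrm{tr}(XY)$. Write $F_{p,q}$ for the symmetric matrix with entries $1$ at $(p,q)$ and $(q,p)$ and $0$ elsewhere, and $E_{1,q}$ for the matrix with entries $-1$ at $(1,q)$, $1$ at $(q,1)$ and $0$ elsewhere. Identify $\mathfrak m$ with $\mathbb R^{4n+2}$ by the orthonormal basis obtained by normalising, in this order, $-\mathrm kF_{1,1},\ \mathrm jF_{1,1}$ and, for $p=1,\dots,n$, $\mathrm jF_{1,p+1},\ \mathrm kF_{1,p+1},\ \mathrm iF_{1,p+1},\ E_{1,p+1}$. Let $\Sigma_{2m}=\Lambda^\bullet\mathrm{span}_{\mathbb C}(y_1,\dots,y_m)$, with the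 Hermitian product for which the monomials $y_{j_1}\wedge\cdots\wedge y_{j_k}$ ($j_1<\dots<j_k$) are orthonormal, and with Clifford multiplication $e_{2j-1}\cdot\eta=\mathrm i(x_j\lrcorner\eta+y_j\wedge\eta)$, $e_{2j}\cdot\eta=y_j\wedge\eta-x_j\lrcorner\eta$, where $x_j\lrcorner$ is contraction with the form dual to $y_j$. Spin$^{\mathbb C}$ spinors are elements of $\Sigma_{4n+2}\otimes\Sigma_2$, with $\Sigma_2=\mathrm{span}(\hat1,\hat y_1)$ and $\hat e_1,\hat e_2$ the standard basis of $\mathbb R^2$. Such a $\psi$ is pure if the endomorphism $\hat\eta$ of $\mathbb R^{4n+2}$ given by $\langle\hat\eta X,Y\rangle=\mathrm{Re}\langle (X\cdot Y+\langle X,Y\rangle)\cdot(\hat e_1\cdot\hat e_2)\cdot\psi,\psi\rangle$ satisfies $\hat\eta^2=-\mathrm{Id}$. For $s=2s'\in2\mathbb Z$, $\psi$ is an invariant spinor of the invariant spin$^{\mathbb C}$ structure with parameter $s$ if it is annihilated by $\mathfrak h$ acting through the spin lift of the isotropy representation and of $\varphi_s:H\to\mathrm U(1)\cong\mathrm{SO}(2)$,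 $(z,A)\mapsto z^s$. Put $\omega=\sum_{p=1}^n y_{2p}\wedge y_{2p+1}$. 1. For every $k\in\mathbb N=\{0,1,2,\dots\}$ the spinors $\omega^k\otimes\hat1$, $(y_1\wedge\omega^k)\otimes\hat1$, $\omega^k\otimes\hat y_1$, $(y_1\wedge\omega^k)\otimes\hat y_1$ are invariant for the structures with $s'=2k-n-1$, $2k-n+1$, $n+1-2k$, $n-1-2k$, respectively. 2. For every $k\in\mathbb N$ and each $\psi$ among these four spinors, some scalar multiple of $\psi$ is pure if and only if $k=0$ or $k=n$. 3. For $s'\in\mathbb Z$, there are a $k\in\mathbb N$, one of these four spinors and a scalar multiple of it which is both pure and an invariant spinor of the structure with $s=2s'$ if and only if $s'\in\{\pm(n+1),\pm(n-1)\}$. -/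

import Mathlib

open scoped TensorProduct Quaternion ComplexConjugate

noncomputable section

namespace SpinCProjective

/-! ### The spin representation in even dimension, in the exterior forms model

`ℝ^{2m}` has the orthonormal basis `e_{(j,0)}, e_{(j,1)}` (`j : Fin m`), in the order
`e_{(0,0)}, e_{(0,1)}, e_{(1,0)}, …`.  Put `x_j = (e_{(j,0)} - i e_{(j,1)})/√2` and
`y_j = (e_{(j,0)} + i e_{(j,1)})/√2`.  The space `L'` spanned by the `y_j` is identified with
`ℂ^m`, and the space of spinors is the exterior algebra of `L'`. -/

/-- Euclidean space `ℝ^{2m}`. -/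
abbrev E (m : ℕ) := EuclideanSpace ℝ (Fin m × Fin 2)

/-- The space of spinors `Σ_{2m} = Λ^• L'`. -/
abbrev Spinor (m : ℕ) := ExteriorAlgebra ℂ (Fin m → ℂ)

/-- The degree-one element `y_j` of the exterior algebra. -/
def y {m : ℕ} (j : Fin m) : Spinor m := ExteriorAlgebra.ι ℂ (Pi.single j 1)

/-- The operator `η ↦ y_j ∧ η`. -/
def wedgeY {m : ℕ} (j : Fin m) : Module.End ℂ (Spinor m) := LinearMap.mulLeft ℂ (y j)

/-- The operator `η ↦ x_j ⌟ η`.  Under the complex bilinear extension of the inner product,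
`x_j` is the linear form on `L'` with `⟨x_j, y_l⟩ = δ_{jl}`, that is, the `j`-th coordinate. -/
def contractX {m : ℕ} (j : Fin m) : Module.End ℂ (Spinor m) :=
  CliffordAlgebra.contractLeft (LinearMap.proj j)

/-- Clifford multiplication by the basis vectors:
`e_{(j,0)} · η = i (x_j ⌟ η + y_j ∧ η)` and `e_{(j,1)} · η = y_j ∧ η - x_j ⌟ η`. -/
def cliffordBasis {m : ℕ} (q : Fin m × Fin 2) : Module.End ℂ (Spinor m) :=
  if q.2 = 0 then Complex.I • (contractX q.1 + wedgeY q.1) else wedgeY q.1 - contractX q.1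

/-- Clifford multiplication by a vector of `ℝ^{2m}`. -/
def clifford {m : ℕ} (X : E m) : Module.End ℂ (Spinor m) :=
  ∑ q, ((X q : ℝ) : ℂ) • cliffordBasis q

/-- The action of `X ∧ Y = X · Y + ⟨X, Y⟩` on spinors. -/
def wedgeAction {m : ℕ} (X Y : E m) : Module.End ℂ (Spinor m) :=
  clifford X * clifford Y + ((inner ℝ X Y : ℝ) : ℂ) • 1

/-- The basis of `Σ_{2m}` formed by the monomials `y_{j_1} ∧ ⋯ ∧ y_{j_k}`, `j_1 < ⋯ < j_k`. -/
def spinorBasis (m : ℕ) : Module.Basis (Finset (Fin m)) ℂ (Spinor m) :=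
  (Pi.basisFun ℂ (Fin m)).ExteriorAlgebra

/-! ### Spin^ℂ spinors and purity -/

/-- The space `Σ_{2m} ⊗ Σ_2` of `1`-twisted spin^ℂ spinors. -/
abbrev SpinCSpinor (m : ℕ) := Spinor m ⊗[ℂ] Spinor 1

/-- The Hermitian product on `Σ_{2m} ⊗ Σ_2`, linear in the first argument, for which the tensor
products of monomials are orthonormal. -/
def herm {m : ℕ} (φ ψ : SpinCSpinor m) : ℂ :=
  ∑ q, ((spinorBasis m).tensorProduct (spinorBasis 1)).repr φ q *
    conj (((spinorBasis m).tensorProduct (spinorBasis 1)).repr ψ q)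

/-- The action of `ê_1 · ê_2` on `Σ_2`, where `(ê_1, ê_2)` is the standard basis of `ℝ^2`. -/
def eHat12 : Module.End ℂ (Spinor 1) := cliffordBasis (0, 0) * cliffordBasis (0, 1)

/-- The real `2`-form `η_{12}^ψ(X, Y) = Re ⟨(X ∧ Y) · (ê_1 · ê_2) · ψ, ψ⟩`. -/
def etaForm {m : ℕ} (ψ : SpinCSpinor m) (X Y : E m) : ℝ :=
  (herm (TensorProduct.map (wedgeAction X Y) eHat12 ψ) ψ).re

/-- The endomorphism `X ↦ (η_{12}^ψ(X, ·))^♯` of `ℝ^{2m}`. -/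
def etaHat {m : ℕ} (ψ : SpinCSpinor m) (X : E m) : E m :=
  WithLp.toLp 2 fun q => etaForm ψ X (EuclideanSpace.single q 1)

/-- A spin^ℂ spinor (twisted spin^r spinor with `r = 2`) is pure if the endomorphism associated
to it squares to `-Id`. -/
def IsPure {m : ℕ} (ψ : SpinCSpinor m) : Prop :=
  ∀ X : E m, etaHat ψ (etaHat ψ X) = -X

/-! ### The homogeneous space `ℂP^{2n+1} = Sp(n+1) / (U(1) × Sp(n))`

`sp(n+1)` is the Lie algebra of skew-Hermitian quaternionic matrices of size `n+1`. -/

/-- Quaternionic matrices of size `n+1`. -/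
abbrev QMat (n : ℕ) := Matrix (Fin (n + 1)) (Fin (n + 1)) ℍ[ℝ]

/-- The imaginary unit `i` of the quaternions. -/
def qi : ℍ[ℝ] := ⟨0, 1, 0, 0⟩

/-- The imaginary unit `j` of the quaternions. -/
def qj : ℍ[ℝ] := ⟨0, 0, 1, 0⟩

/-- The imaginary unit `k` of the quaternions. -/
def qk : ℍ[ℝ] := ⟨0, 0, 0, 1⟩

/-- The isotropy subalgebra `u(1) ⊕ sp(n)` of `sp(n+1)`: the upper left entry lies in `ℝ i`, and
the lower right block is skew-Hermitian. -/
def isotropyAlgebra (n : ℕ) : Set (QMat n) :=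
  {X | X.conjTranspose = -X ∧ (∀ p : Fin n, X 0 p.succ = 0 ∧ X p.succ 0 = 0) ∧
    (X 0 0).imJ = 0 ∧ (X 0 0).imK = 0}

/-- `B_0(X, Y) = -Re tr(XY)`. -/
def B0 {n : ℕ} (X Y : QMat n) : ℝ := -((X * Y).trace).re

/-- The component of a matrix in the upper left `1 × 1` block.  On the reductive complement
`𝔪 = 𝒱 ⊕ ℋ` of the isotropy subalgebra this is the projection to `𝒱`. -/
def vert {n : ℕ} (X : QMat n) : QMat n := Matrix.single 0 0 (X 0 0)

/-- The invariant metric `g_{a,t} = a B_0|_ℋ + 2 a t B_0|_𝒱` on `𝔪`. -/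
def metric {n : ℕ} (a t : ℝ) (X Y : QMat n) : ℝ :=
  a * B0 (X - vert X) (Y - vert Y) + 2 * a * t * B0 (vert X) (vert Y)

/-- `u F_{1,p+1}`, for a quaternion `u`: the entries `(1,p+1)` and `(p+1,1)` are `u`. -/
def symF {n : ℕ} (u : ℍ[ℝ]) (p : Fin n) : QMat n :=
  Matrix.single 0 p.succ u + Matrix.single p.succ 0 u

/-- `E_{1,p+1}`: the entry `(1,p+1)` is `-1` and the entry `(p+1,1)` is `1`. -/
def skewE {n : ℕ} (p : Fin n) : QMat n :=
  Matrix.single p.succ 0 1 - Matrix.single 0 p.succ 1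

/-- The basis of `𝔪` before normalisation.  The index `(0, ·)` gives `ξ_2 = -k F_{1,1}` and
`ξ_3 = j F_{1,1}`.  For `p : Fin n` (counted from `0`), the indices `(2p+1, ·)` give
`j F_{1,p+2}`, `k F_{1,p+2}` and the indices `(2p+2, ·)` give `i F_{1,p+2}`, `E_{1,p+2}`. -/
def frame₀ (n : ℕ) : Fin (2 * n + 1) × Fin 2 → QMat n
  | (⟨0, _⟩, ε) => if ε = 0 then Matrix.single 0 0 (-qk) else Matrix.single 0 0 qj
  | (⟨l + 1, h⟩, ε) =>
    if l % 2 = 0 then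
      if ε = 0 then symF qj ⟨l / 2, by omega⟩ else symF qk ⟨l / 2, by omega⟩
    else
      if ε = 0 then symF qi ⟨l / 2, by omega⟩ else skewE ⟨l / 2, by omega⟩

/-- The positively oriented `g_{a,t}`-orthonormal basis
`ξ_2^{a,t}, ξ_3^{a,t}, e_4^{a,t}, …, e_{4n+3}^{a,t}` of `𝔪`, through which `𝔪` is identified
with `ℝ^{4n+2}`. -/
def frame (n : ℕ) (a t : ℝ) (q : Fin (2 * n + 1) × Fin 2) : QMat n :=
  (if q.1 = 0 then (Real.sqrt (2 * t * a))⁻¹ else (Real.sqrt (2 * a))⁻¹) • frame₀ n q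

/-- The isotropy representation `σ_*(X) = ad(X)|_𝔪` of `X ∈ 𝔥`, as a matrix in the orthonormal
basis: the entry `(q, r)` is the component of `[X, e_r]` along `e_q`. -/
def isotropyRep (n : ℕ) (a t : ℝ) (X : QMat n) :
    Matrix (Fin (2 * n + 1) × Fin 2) (Fin (2 * n + 1) × Fin 2) ℝ :=
  Matrix.of fun q r => metric a t ⁅X, frame n a t r⁆ (frame n a t q)

/-- The action on spinors of the spin lift of a skew-symmetric matrix `A`.  Here
`A = ∑_{r < q} A_{qr} e_r ∧ e_q`, where `e_r ∧ e_q` sends `e_r` to `e_q` and `e_q` to `-e_r`, and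
the lift of `2 e_r ∧ e_q` is `e_r · e_q`; hence the lift of `A` is `1/4 ∑_{q,r} A_{qr} e_r · e_q`. -/
def spinLift {m : ℕ} (A : Matrix (Fin m × Fin 2) (Fin m × Fin 2) ℝ) :
    Module.End ℂ (Spinor m) :=
  (1 / 4 : ℂ) • ∑ q, ∑ r, ((A q r : ℝ) : ℂ) • (cliffordBasis r * cliffordBasis q)

/-- The differential action of `X ∈ 𝔥` on `Σ_{4n+2} ⊗ Σ_2` through the lift `φ_s` to
`Spin^ℂ(4n+2)` of `σ × φ_s`, where the second `φ_s : U(1) × Sp(n) → SO(2) = U(1)` is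
`(z, A) ↦ z^s`.  If the upper left entry of `X` is `x i`, the differential of the latter at `X`
is `s x ê_1 ∧ ê_2`, whose spin lift is `(s x / 2) ê_1 · ê_2`. -/
def isotropyAction (n : ℕ) (a t : ℝ) (s : ℤ) (X : QMat n) :
    Module.End ℂ (SpinCSpinor (2 * n + 1)) :=
  TensorProduct.map (spinLift (isotropyRep n a t X)) 1 +
    TensorProduct.map 1 (((s : ℂ) * (((X 0 0).imI : ℝ) : ℂ) / 2) • eHat12)

/-- `ψ` is an `Sp(n+1)`-invariant spin^ℂ spinor on `(ℂP^{2n+1}, g_{a,t})` for the invariant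
spin^ℂ structure `Sp(n+1) ×_{φ_s} Spin^ℂ(4n+2)`.  Invariant spinors are the elements of
`Σ_{4n+2} ⊗ Σ_2` fixed by the isotropy group; as this group is connected, these are the elements
annihilated by its Lie algebra. -/
def IsInvariantSpinor (n : ℕ) (a t : ℝ) (s : ℤ) (ψ : SpinCSpinor (2 * n + 1)) : Prop :=
  ∀ X ∈ isotropyAlgebra n, isotropyAction n a t s X ψ = 0

/-- `ω = ∑_{p=1}^n y_{2p} ∧ y_{2p+1}`; the index `1` of the mathematical notation is the element
`0` of `Fin (2n+1)`. -/
def omega (n : ℕ) : Spinor (2 * n + 1) :=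
  ∑ p : Fin n, y ⟨2 * p + 1, by omega⟩ * y ⟨2 * p + 2, by omega⟩

/-- The spinor `y_1` of `Σ_{4n+2}`. -/
def y1 (n : ℕ) : Spinor (2 * n + 1) := y 0

/-- The spinor `1̂` of `Σ_2`. -/
def oneHat : Spinor 1 := 1

/-- The spinor `ŷ_1` of `Σ_2`. -/
def yHat : Spinor 1 := y 0

end SpinCProjective

end

/-!
# Pure invariant spin^ℂ spinors on `ℂP^{2n+1}`

Everything takes place in the algebra generated by the creation operators `y_l ∧` and the
annihilation operators `x_l ⌟`, which satisfy the canonical anticommutation relations. The products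
`y_l ∧ (x_j ⌟ ·)` (`transfer l j`) span a copy of `𝔤𝔩(2n+1, ℂ)` acting by derivations; those
combinations which preserve the symplectic form `ω` and do not involve `y_1` (`sympA`, `sympB`,
`sympC`) form `𝔰𝔭(2n, ℂ)`, and they annihilate every power of `ω` and every `y_1 ∧ ω^k`. These
spinors are also eigenvectors of the degree in `y_1` and of the degree in the other variables.

*Invariance.* In quaternionic coordinates, the element of the isotropy algebra with upper left entry
`x i` and lower right block `M` acts on the horizontal space `ℍ^n` by `w ↦ M w - w x i`, and on the
vertical space by a rotation. The normalisation of the frame cancels `a` and `t`. In the spin lift,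
the terms with two creation or two annihilation operators cancel, so that `M` contributes an element
of `𝔰𝔭(2n, ℂ)`, which kills the four spinors, and `x i` contributes a scalar which depends on the
two degrees (`spinLift_isotropyRep_omegaSpinor`). Invariance amounts to the vanishing of this scalar
plus the one coming from the twist by `s`.

*Purity.* The creation and annihilation operators are adjoint to each other, so that the `2`-form of
a spinor consists of expectation values of quadratic operators. Such a value vanishes whenever the
operator shifts the weight with respect to the total degree, to the degree in `y_1`, or to one of
the elements of the Cartan subalgebra of `𝔰𝔭(2n, ℂ)`. What remains are the expectations of
`1 - 2 N_l`, with `N_l` the degree in `y_l`. For `l ≠ 1` the symmetry under `𝔰𝔭(2n, ℂ)` makes them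
independent of `l`, hence equal to `1 - 2k/n` times the squared norm of the spinor, while for
`l = 1` one gets `±1` times the squared norm. Therefore `η̂` is block diagonal with rotations by a
right angle scaled by these numbers, and a multiple of the spinor is pure if and only if
`(1 - 2k/n)^2 = 1` and the spinor does not vanish. That `ω^n` does not vanish follows from the
`𝔰𝔩₂`-relation between `ω ∧` and its adjoint (`contractOmega_omega_pow_succ`).

The last claim combines both: an invariant pure spinor is nonzero, which determines `s'`.
-/

noncomputable section

namespace SpinCProjective

variable {m n : ℕ}

/-! ### Creation and annihilation operators -/

/-- A shortcut to the ring structure, which unification does not find by itself. -/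
instance instRingEndSpinor : Ring (Module.End ℂ (Spinor m)) := inferInstance

theorem wedgeY_apply (j : Fin m) (η : Spinor m) : wedgeY j η = y j * η := rfl

theorem contractX_one (j : Fin m) : contractX j (1 : Spinor m) = 0 :=
  CliffordAlgebra.contractLeft_one (Q := (0 : QuadraticForm ℂ (Fin m → ℂ))) _

theorem wedgeY_mul_wedgeY (j l : Fin m) : wedgeY j * wedgeY l = -(wedgeY l * wedgeY j) := by
  refine LinearMap.ext fun η => ?_
  have h := ExteriorAlgebra.ι_add_mul_swap (R := ℂ) (Pi.single j 1 : Fin m → ℂ) (Pi.single l 1)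
  rw [LinearMap.neg_apply, Module.End.mul_apply, Module.End.mul_apply, wedgeY_apply, wedgeY_apply,
    wedgeY_apply, wedgeY_apply, ← mul_assoc, ← mul_assoc, y, y, eq_neg_of_add_eq_zero_left h,
    neg_mul]

theorem wedgeY_mul_self (j : Fin m) : wedgeY j * wedgeY j = 0 := by
  refine LinearMap.ext fun η => ?_
  rw [Module.End.mul_apply, wedgeY_apply, wedgeY_apply, ← mul_assoc, y,
    ExteriorAlgebra.ι_sq_zero, zero_mul, LinearMap.zero_apply]

theorem contractX_mul_contractX (j l : Fin m) :
    contractX j * contractX l = -(contractX l * contractX j) := by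
  refine LinearMap.ext fun η => ?_
  exact CliffordAlgebra.contractLeft_comm (Q := (0 : QuadraticForm ℂ (Fin m → ℂ))) _ _ η

theorem contractX_mul_self (j : Fin m) : contractX j * contractX j = 0 := by
  refine LinearMap.ext fun η => ?_
  exact CliffordAlgebra.contractLeft_contractLeft (Q := (0 : QuadraticForm ℂ (Fin m → ℂ))) _ η

theorem contractX_mul_wedgeY (j l : Fin m) :
    contractX j * wedgeY l = (if j = l then 1 else 0) - wedgeY l * contractX j := by
  refine LinearMap.ext fun η => ?_
  have h := CliffordAlgebra.contractLeft_ι_mul (Q := (0 : QuadraticForm ℂ (Fin m → ℂ)))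
    (d := LinearMap.proj j) (Pi.single l (1 : ℂ)) η
  refine h.trans ?_
  rw [LinearMap.sub_apply]
  congr 1
  rcases eq_or_ne j l with rfl | hjl
  · simp
  · simp [hjl]

/-- The operator `y_l ∧ (x_j ⌟ ·)`, that is, the derivation sending `y_j` to `y_l`. -/
def transfer (l j : Fin m) : Module.End ℂ (Spinor m) := wedgeY l * contractX j

theorem transfer_one (l j : Fin m) : transfer l j 1 = 0 := by
  rw [transfer, Module.End.mul_apply, contractX_one, map_zero]

theorem transfer_mul_wedgeY (l j k : Fin m) :
    transfer l j * wedgeY k = wedgeY k * transfer l j + (if j = k then 1 else 0) * wedgeY l := by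
  have h1 := contractX_mul_wedgeY j k
  have h2 := wedgeY_mul_wedgeY l k
  rw [transfer, mul_assoc, h1, mul_sub, ← mul_assoc, h2]
  split_ifs <;> noncomm_ring

theorem transfer_mul_contractX (l j k : Fin m) :
    transfer l j * contractX k =
      contractX k * transfer l j - (if k = l then 1 else 0) * contractX j := by
  have h1 := contractX_mul_wedgeY k l
  have h2 := contractX_mul_contractX j k
  rw [transfer, mul_assoc, h2, ← mul_assoc (contractX k), h1]
  split_ifs <;> noncomm_ring

/-- The commutation relations of the general linear Lie algebra. -/
theorem transfer_mul_transfer (l j l' j' : Fin m) :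
    transfer l j * transfer l' j' = transfer l' j' * transfer l j +
      (if j = l' then 1 else 0) * transfer l j' - (if j' = l then 1 else 0) * transfer l' j := by
  have h1 := transfer_mul_wedgeY l j l'
  have h2 := transfer_mul_contractX l j j'
  calc transfer l j * transfer l' j' = (transfer l j * wedgeY l') * contractX j' := by
        rw [show transfer l' j' = wedgeY l' * contractX j' from rfl, mul_assoc]
    _ = wedgeY l' * (transfer l j * contractX j') +
          (if j = l' then 1 else 0) * (wedgeY l * contractX j') := by rw [h1]; noncomm_ring
    _ = _ := by
        rw [h2]; simp only [transfer]; split_ifs <;> noncomm_ring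

/-! ### The form `ω` and its powers -/

/-- The index of `y_{2p}`, the first of the two coordinates attached to `p`, where `p` is counted
from `1` in the mathematical notation and from `0` in `Fin n`. -/
def fstIdx (p : Fin n) : Fin (2 * n + 1) := ⟨2 * p + 1, by omega⟩

/-- The index of `y_{2p+1}`, the second of the two coordinates attached to `p`, with the same
convention. -/
def sndIdx (p : Fin n) : Fin (2 * n + 1) := ⟨2 * p + 2, by omega⟩

@[simp] theorem fstIdx_inj (p q : Fin n) : fstIdx p = fstIdx q ↔ p = q := by
  simp [fstIdx, Fin.ext_iff]

@[simp] theorem sndIdx_inj (p q : Fin n) : sndIdx p = sndIdx q ↔ p = q := by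
  simp [sndIdx, Fin.ext_iff]

@[simp] theorem fstIdx_ne_sndIdx (p q : Fin n) : fstIdx p ≠ sndIdx q := by
  simp only [fstIdx, sndIdx, ne_eq, Fin.ext_iff]; omega

@[simp] theorem sndIdx_ne_fstIdx (p q : Fin n) : sndIdx p ≠ fstIdx q :=
  (fstIdx_ne_sndIdx q p).symm

@[simp] theorem fstIdx_ne_zero (p : Fin n) : fstIdx p ≠ 0 := by
  simp [fstIdx, Fin.ext_iff]

@[simp] theorem sndIdx_ne_zero (p : Fin n) : sndIdx p ≠ 0 := by
  simp [sndIdx, Fin.ext_iff]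

@[simp] theorem zero_ne_fstIdx (p : Fin n) : 0 ≠ fstIdx p := (fstIdx_ne_zero p).symm

@[simp] theorem zero_ne_sndIdx (p : Fin n) : 0 ≠ sndIdx p := (sndIdx_ne_zero p).symm

theorem index_cases (l : Fin (2 * n + 1)) :
    l = 0 ∨ (∃ p : Fin n, l = fstIdx p) ∨ ∃ p : Fin n, l = sndIdx p := by
  obtain ⟨l, hl⟩ := l
  rcases Nat.eq_zero_or_pos l with rfl | h0
  · exact Or.inl rfl
  · rcases Nat.even_or_odd' l with ⟨c, rfl | rfl⟩
    · exact Or.inr (Or.inr ⟨⟨c - 1, by omega⟩, by simp only [sndIdx, Fin.mk.injEq]; omega⟩)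
    · exact Or.inr (Or.inl ⟨⟨c, by omega⟩, rfl⟩)

theorem sum_index {M : Type*} [AddCommMonoid M] (f : Fin (2 * n + 1) → M) :
    ∑ l, f l = f 0 + ∑ p : Fin n, (f (fstIdx p) + f (sndIdx p)) := by
  rw [Fin.sum_univ_succ]
  congr 1
  rw [← Equiv.sum_comp (finProdFinEquiv.trans (finCongr (Nat.mul_comm n 2))),
    Fintype.sum_prod_type]
  refine Finset.sum_congr rfl fun p _ => ?_
  rw [Fin.sum_univ_two]
  congr 2
  · ext; simp [fstIdx]
  · ext; simp [sndIdx]; omega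

/-- Multiplication by `ω`. -/
def wedgeOmega (n : ℕ) : Module.End ℂ (Spinor (2 * n + 1)) :=
  ∑ p : Fin n, wedgeY (fstIdx p) * wedgeY (sndIdx p)

theorem wedgeOmega_apply (η : Spinor (2 * n + 1)) : wedgeOmega n η = omega n * η := by
  rw [wedgeOmega, omega, Finset.sum_mul, LinearMap.sum_apply]
  exact Finset.sum_congr rfl fun p _ => (mul_assoc (y (fstIdx p)) (y (sndIdx p)) η).symm

theorem commute_wedgeY_wedgeOmega (j : Fin (2 * n + 1)) : Commute (wedgeY j) (wedgeOmega n) := by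
  refine Commute.sum_right _ _ _ fun p _ => ?_
  have h1 := wedgeY_mul_wedgeY j (fstIdx p)
  have h2 := wedgeY_mul_wedgeY j (sndIdx p)
  change _ * _ = _ * _
  rw [← mul_assoc, h1, mul_assoc, neg_mul, mul_assoc, h2]
  noncomm_ring

theorem transfer_mul_wedge_pair (l j : Fin (2 * n + 1)) (p : Fin n) :
    transfer l j * (wedgeY (fstIdx p) * wedgeY (sndIdx p)) =
      wedgeY (fstIdx p) * wedgeY (sndIdx p) * transfer l j
      + ((if j = fstIdx p then 1 else 0) * (wedgeY l * wedgeY (sndIdx p))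
      + (if j = sndIdx p then 1 else 0) * (wedgeY (fstIdx p) * wedgeY l)) := by
  rw [← mul_assoc, transfer_mul_wedgeY, add_mul, mul_assoc (wedgeY (fstIdx p)),
    transfer_mul_wedgeY]
  split_ifs <;> noncomm_ring

theorem transfer_fst_mul_wedgeOmega (l : Fin (2 * n + 1)) (q : Fin n) :
    transfer l (fstIdx q) * wedgeOmega n =
      wedgeOmega n * transfer l (fstIdx q) + wedgeY l * wedgeY (sndIdx q) := by
  rw [wedgeOmega, Finset.mul_sum, Finset.sum_mul]
  simp [transfer_mul_wedge_pair, Finset.sum_add_distrib]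

theorem transfer_snd_mul_wedgeOmega (l : Fin (2 * n + 1)) (q : Fin n) :
    transfer l (sndIdx q) * wedgeOmega n =
      wedgeOmega n * transfer l (sndIdx q) + wedgeY (fstIdx q) * wedgeY l := by
  rw [wedgeOmega, Finset.mul_sum, Finset.sum_mul]
  simp [transfer_mul_wedge_pair, Finset.sum_add_distrib]

theorem transfer_zero_mul_wedgeOmega (l : Fin (2 * n + 1)) :
    transfer l 0 * wedgeOmega n = wedgeOmega n * transfer l 0 := by
  rw [wedgeOmega, Finset.mul_sum, Finset.sum_mul]
  simp [transfer_mul_wedge_pair]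

/-- The spinor `y_1^ε ∧ ω^k`, for `ε = 0, 1`. It vanishes for `k > n`. -/
def omegaSpinor (n k : ℕ) (ε : Fin 2) : Spinor (2 * n + 1) := y1 n ^ (ε : ℕ) * omega n ^ k

theorem omegaSpinor_zero (n k : ℕ) : omegaSpinor n k 0 = omega n ^ k := by simp [omegaSpinor]

theorem omegaSpinor_one (n k : ℕ) : omegaSpinor n k 1 = y1 n * omega n ^ k := by
  simp [omegaSpinor]

theorem omegaSpinor_zero_zero (n : ℕ) : omegaSpinor n 0 0 = 1 := by simp [omegaSpinor]

theorem omegaSpinor_one_eq_wedgeY (n k : ℕ) :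
    omegaSpinor n k 1 = wedgeY 0 (omegaSpinor n k 0) := by
  rw [omegaSpinor_one, omegaSpinor_zero, wedgeY_apply, y1]

theorem omegaSpinor_succ (n k : ℕ) (ε : Fin 2) :
    omegaSpinor n (k + 1) ε = wedgeOmega n (omegaSpinor n k ε) := by
  have h0 : omegaSpinor n (k + 1) 0 = wedgeOmega n (omegaSpinor n k 0) := by
    rw [wedgeOmega_apply, omegaSpinor_zero, omegaSpinor_zero, pow_succ']
  fin_cases ε
  · exact h0
  · change omegaSpinor n (k + 1) 1 = wedgeOmega n (omegaSpinor n k 1)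
    rw [omegaSpinor_one_eq_wedgeY, omegaSpinor_one_eq_wedgeY, h0]
    exact LinearMap.congr_fun (commute_wedgeY_wedgeOmega 0) _

/-- An operator which kills `1` and has commutators `[T, y_1] = ρ y_1` and `[T, ω] = r ω` acts on
`y_1^ε ∧ ω^k` by the scalar `ερ + kr`. -/
theorem omegaSpinor_eigen {T : Module.End ℂ (Spinor (2 * n + 1))} {ρ r : ℂ} (h1 : T 1 = 0)
    (hy : T * wedgeY 0 = wedgeY 0 * T + ρ • wedgeY 0)
    (hω : T * wedgeOmega n = wedgeOmega n * T + r • wedgeOmega n) (k : ℕ) (ε : Fin 2) :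
    T (omegaSpinor n k ε) = ((ε : ℕ) * ρ + k * r) • omegaSpinor n k ε := by
  have step : ∀ {S : Module.End ℂ (Spinor (2 * n + 1))} {s μ : ℂ} {φ : Spinor (2 * n + 1)},
      T * S = S * T + s • S → T φ = μ • φ → T (S φ) = (μ + s) • S φ := by
    intro S s μ φ hS hφ
    have := LinearMap.congr_fun hS φ
    simp only [Module.End.mul_apply, LinearMap.add_apply, LinearMap.smul_apply, hφ, map_smul]
      at this
    rw [this, add_smul]
  induction k with
  | zero =>
    have h0 : T (omegaSpinor n 0 0) = (0 : ℂ) • omegaSpinor n 0 0 := by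
      rw [omegaSpinor_zero_zero, h1, zero_smul]
    fin_cases ε
    · simpa using h0
    · simpa [omegaSpinor_one_eq_wedgeY] using step hy h0
  | succ k ih =>
    rw [omegaSpinor_succ, step hω ih]
    congr 1
    push_cast
    ring

theorem omegaSpinor_kill {T : Module.End ℂ (Spinor (2 * n + 1))} (h1 : T 1 = 0)
    (hy : T * wedgeY 0 = wedgeY 0 * T) (hω : T * wedgeOmega n = wedgeOmega n * T)
    (k : ℕ) (ε : Fin 2) : T (omegaSpinor n k ε) = 0 := by
  simpa using omegaSpinor_eigen (ρ := 0) (r := 0) h1 (by simpa using hy) (by simpa using hω) k ε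

/-- The element of `𝔰𝔭(2n, ℂ)` sending `y_{2q}` to `y_{2p}` and `y_{2p+1}` to `-y_{2q+1}`. -/
def sympA (p q : Fin n) : Module.End ℂ (Spinor (2 * n + 1)) :=
  transfer (fstIdx p) (fstIdx q) - transfer (sndIdx q) (sndIdx p)

/-- The element of `𝔰𝔭(2n, ℂ)` sending `y_{2q+1}` to `y_{2p}` and `y_{2p+1}` to `y_{2q}`. -/
def sympB (p q : Fin n) : Module.End ℂ (Spinor (2 * n + 1)) :=
  transfer (fstIdx p) (sndIdx q) + transfer (fstIdx q) (sndIdx p)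

/-- The element of `𝔰𝔭(2n, ℂ)` sending `y_{2q}` to `y_{2p+1}` and `y_{2p}` to `y_{2q+1}`. -/
def sympC (p q : Fin n) : Module.End ℂ (Spinor (2 * n + 1)) :=
  transfer (sndIdx p) (fstIdx q) + transfer (sndIdx q) (fstIdx p)

theorem sympA_omegaSpinor (p q : Fin n) (k : ℕ) (ε : Fin 2) :
    sympA p q (omegaSpinor n k ε) = 0 := by
  refine omegaSpinor_kill ?_ ?_ ?_ k ε
  · simp [sympA, transfer_one]
  · simp [sympA, sub_mul, mul_sub, transfer_mul_wedgeY]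
  · rw [sympA, sub_mul, mul_sub, transfer_fst_mul_wedgeOmega, transfer_snd_mul_wedgeOmega]
    abel

theorem sympB_omegaSpinor (p q : Fin n) (k : ℕ) (ε : Fin 2) :
    sympB p q (omegaSpinor n k ε) = 0 := by
  refine omegaSpinor_kill ?_ ?_ ?_ k ε
  · simp [sympB, transfer_one]
  · simp [sympB, add_mul, mul_add, transfer_mul_wedgeY]
  · rw [sympB, add_mul, mul_add, transfer_snd_mul_wedgeOmega, transfer_snd_mul_wedgeOmega,
      wedgeY_mul_wedgeY (fstIdx q)]
    abel

theorem sympC_omegaSpinor (p q : Fin n) (k : ℕ) (ε : Fin 2) :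
    sympC p q (omegaSpinor n k ε) = 0 := by
  refine omegaSpinor_kill ?_ ?_ ?_ k ε
  · simp [sympC, transfer_one]
  · simp [sympC, add_mul, mul_add, transfer_mul_wedgeY]
  · rw [sympC, add_mul, mul_add, transfer_fst_mul_wedgeOmega, transfer_fst_mul_wedgeOmega,
      wedgeY_mul_wedgeY (sndIdx q)]
    abel

theorem transfer_zero_zero_omegaSpinor (k : ℕ) (ε : Fin 2) :
    transfer 0 0 (omegaSpinor n k ε) = ((ε : ℕ) : ℂ) • omegaSpinor n k ε := by
  have h := omegaSpinor_eigen (n := n) (T := transfer 0 0) (ρ := 1) (r := 0) (transfer_one _ _)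
    (by simp [transfer_mul_wedgeY]) (by simp [transfer_zero_mul_wedgeOmega]) k ε
  simpa using h

/-- The degree in the variables `y_2, …, y_{2n+1}`. -/
def horDegree (n : ℕ) : Module.End ℂ (Spinor (2 * n + 1)) :=
  ∑ p : Fin n, (transfer (fstIdx p) (fstIdx p) + transfer (sndIdx p) (sndIdx p))

theorem horDegree_mul_wedgeOmega (n : ℕ) :
    horDegree n * wedgeOmega n = wedgeOmega n * horDegree n + (2 : ℂ) • wedgeOmega n := by
  rw [horDegree, Finset.sum_mul, Finset.mul_sum]
  conv_rhs => rw [wedgeOmega, Finset.smul_sum, ← Finset.sum_add_distrib, ← wedgeOmega]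
  refine Finset.sum_congr rfl fun p _ => ?_
  rw [add_mul, transfer_fst_mul_wedgeOmega, transfer_snd_mul_wedgeOmega, two_smul]
  noncomm_ring

theorem horDegree_omegaSpinor (k : ℕ) (ε : Fin 2) :
    horDegree n (omegaSpinor n k ε) = (2 * k : ℂ) • omegaSpinor n k ε := by
  have h := omegaSpinor_eigen (n := n) (T := horDegree n) (ρ := 0) (r := 2)
    (by simp [horDegree, transfer_one])
    (by simp [horDegree, Finset.sum_mul, Finset.mul_sum, add_mul, mul_add, transfer_mul_wedgeY])
    (horDegree_mul_wedgeOmega n) k ε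
  rw [h]
  congr 1
  ring

/-! ### Nonvanishing of the powers of `ω` -/

/-- The operator adjoint to multiplication by `ω`. -/
def contractOmega (n : ℕ) : Module.End ℂ (Spinor (2 * n + 1)) :=
  ∑ p : Fin n, contractX (sndIdx p) * contractX (fstIdx p)

/-- Only the summand of `ω` attached to `p` fails to commute with the two contractions. -/
theorem contract_pair_mul_wedgeOmega (p : Fin n) :
    contractX (sndIdx p) * contractX (fstIdx p) * wedgeOmega n =
      wedgeOmega n * (contractX (sndIdx p) * contractX (fstIdx p)) + 1
        - (transfer (fstIdx p) (fstIdx p) + transfer (sndIdx p) (sndIdx p)) := by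
  have h1 : contractX (fstIdx p) * wedgeOmega n =
      wedgeOmega n * contractX (fstIdx p) + wedgeY (sndIdx p) := by
    have : ∀ q, contractX (fstIdx p) * (wedgeY (fstIdx q) * wedgeY (sndIdx q)) =
        wedgeY (fstIdx q) * wedgeY (sndIdx q) * contractX (fstIdx p) +
          (if p = q then 1 else 0) * wedgeY (sndIdx q) := fun q => by
      rw [← mul_assoc, contractX_mul_wedgeY, sub_mul, mul_assoc, contractX_mul_wedgeY]
      simp only [fstIdx_inj, fstIdx_ne_sndIdx, if_false]
      split_ifs <;> noncomm_ring
    rw [wedgeOmega, Finset.mul_sum, Finset.sum_mul]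
    simp [this, Finset.sum_add_distrib]
  have h2 : contractX (sndIdx p) * wedgeOmega n =
      wedgeOmega n * contractX (sndIdx p) - wedgeY (fstIdx p) := by
    have : ∀ q, contractX (sndIdx p) * (wedgeY (fstIdx q) * wedgeY (sndIdx q)) =
        wedgeY (fstIdx q) * wedgeY (sndIdx q) * contractX (sndIdx p) -
          (if p = q then 1 else 0) * wedgeY (fstIdx q) := fun q => by
      rw [← mul_assoc, contractX_mul_wedgeY, sub_mul, mul_assoc, contractX_mul_wedgeY]
      simp only [sndIdx_inj, sndIdx_ne_fstIdx, if_false]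
      split_ifs <;> noncomm_ring
    rw [wedgeOmega, Finset.mul_sum, Finset.sum_mul]
    simp [this, Finset.sum_sub_distrib]
  rw [mul_assoc, h1, mul_add, ← mul_assoc, h2, contractX_mul_wedgeY, if_pos rfl, transfer, transfer]
  noncomm_ring

theorem contractOmega_mul_wedgeOmega (n : ℕ) :
    contractOmega n * wedgeOmega n =
      wedgeOmega n * contractOmega n + (n : ℂ) • 1 - horDegree n := by
  rw [contractOmega, Finset.sum_mul, Finset.mul_sum, horDegree]
  simp_rw [contract_pair_mul_wedgeOmega]
  rw [Finset.sum_sub_distrib, Finset.sum_add_distrib]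
  simp [Algebra.smul_def]

/-- The `𝔰𝔩₂`-relation responsible for `ω^{k+1} ≠ 0` when `k < n`. -/
theorem contractOmega_omega_pow_succ (k : ℕ) :
    contractOmega n (omegaSpinor n (k + 1) 0) =
      ((k + 1) * (n - k) : ℂ) • omegaSpinor n k 0 := by
  have key : ∀ k, contractOmega n (omegaSpinor n (k + 1) 0) =
      wedgeOmega n (contractOmega n (omegaSpinor n k 0)) +
        (n - 2 * k : ℂ) • omegaSpinor n k 0 := fun k => by
    have h := LinearMap.congr_fun (contractOmega_mul_wedgeOmega n) (omegaSpinor n k 0)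
    simp only [Module.End.mul_apply, LinearMap.sub_apply, LinearMap.add_apply,
      LinearMap.smul_apply, Module.End.one_apply, horDegree_omegaSpinor] at h
    rw [omegaSpinor_succ, h, sub_smul, add_sub_assoc]
  induction k with
  | zero =>
    rw [key, omegaSpinor_zero_zero]
    simp [contractOmega, contractX_one]
  | succ k ih =>
    rw [key, ih, map_smul, ← omegaSpinor_succ, ← add_smul]
    congr 1
    push_cast
    ring

theorem omegaSpinor_ne_zero {k : ℕ} (hk : k ≤ n) (ε : Fin 2) : omegaSpinor n k ε ≠ 0 := by
  have h0 : omegaSpinor n k 0 ≠ 0 := by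
    induction k with
    | zero => rw [omegaSpinor_zero_zero]; exact one_ne_zero
    | succ k ih =>
      intro h
      have h2 := contractOmega_omega_pow_succ (n := n) k
      rw [h, map_zero, eq_comm, smul_eq_zero] at h2
      rcases h2 with h2 | h2
      · rcases mul_eq_zero.mp h2 with h3 | h3
        · exact Nat.cast_add_one_ne_zero k h3
        · rw [sub_eq_zero, Nat.cast_inj] at h3
          omega
      · exact ih (by omega) h2
  fin_cases ε
  · exact h0
  · change omegaSpinor n k 1 ≠ 0
    intro h
    -- `y_1 ∧ (x_1 ⌟ ·)` kills `ω^k`, so that `x_1 ⌟ (y_1 ∧ ω^k)` determines `ω^k`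
    have h1 := LinearMap.congr_fun (contractX_mul_wedgeY (0 : Fin (2 * n + 1)) 0)
      (omegaSpinor n k 0)
    have h2 := transfer_zero_zero_omegaSpinor (n := n) k 0
    rw [Module.End.mul_apply, ← omegaSpinor_one_eq_wedgeY, h, map_zero] at h1
    rw [transfer] at h2
    simp [-Module.End.mul_apply, h2] at h1
    exact h0 h1.symm

/-! ### The Hermitian product on spinors -/

theorem spinorBasis_empty : spinorBasis m ∅ = 1 := by
  rw [spinorBasis, ExteriorAlgebra.basis_apply_ofCard _ Finset.card_empty]
  simp [ExteriorAlgebra.ιMulti_family]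

theorem spinorBasis_singleton (l : Fin m) : spinorBasis m {l} = y l := by
  rw [spinorBasis, ExteriorAlgebra.basis_apply_ofCard _ (Finset.card_singleton l)]
  simp [ExteriorAlgebra.ιMulti_family, ExteriorAlgebra.ιMulti_succ_apply, y,
    Set.powersetCard.ofFinEmbEquiv, Finset.orderEmbOfFin_singleton]

theorem wedgeY_spinorBasis_of_mem {l : Fin m} {S : Finset (Fin m)} (h : l ∈ S) :
    wedgeY l (spinorBasis m S) = 0 := by
  have := ExteriorAlgebra.basis_mul_of_not_disjoint (Pi.basisFun ℂ (Fin m))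
    (Set.powersetCard.ofCard (Finset.card_singleton l)) (Set.powersetCard.ofCard (rfl : S.card = _))
    (by simpa [Set.powersetCard.ofCard] using h)
  rw [wedgeY_apply, ← spinorBasis_singleton]
  exact this

/-- Wedging a monomial with a new variable gives a monomial up to a sign `ε`, described here as a
real number of square `1`. -/
theorem wedgeY_spinorBasis_of_notMem {l : Fin m} {S : Finset (Fin m)} (h : l ∉ S) :
    ∃ ε : ℂ, conj ε = ε ∧ ε * ε = 1 ∧
      wedgeY l (spinorBasis m S) = ε • spinorBasis m (insert l S) := by
  have hd : Disjoint (Set.powersetCard.ofCard (Finset.card_singleton l)).val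
      (Set.powersetCard.ofCard (rfl : S.card = _)).val := by
    simpa [Set.powersetCard.ofCard] using h
  have key := ExteriorAlgebra.basis_mul_of_disjoint (Pi.basisFun ℂ (Fin m)) _ _ hd
  have hins : ((Set.powersetCard.disjUnion hd).val : Finset (Fin m)) = insert l S := by
    ext x
    simp [Set.powersetCard.disjUnion, Set.powersetCard.ofCard]
  rw [wedgeY_apply, ← spinorBasis_singleton]
  rcases Int.units_eq_one_or (Equiv.Perm.sign (Set.powersetCard.permOfDisjoint hd)) with hs | hs
  · refine ⟨1, by simp, by simp, ?_⟩
    rw [hs, hins, one_smul] at key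
    rw [one_smul]
    exact key
  · refine ⟨-1, by simp, by simp, ?_⟩
    rw [hs, hins, Units.neg_smul, one_smul] at key
    rw [neg_smul, one_smul]
    exact key

theorem contractX_spinorBasis_of_notMem {l : Fin m} {S : Finset (Fin m)} (h : l ∉ S) :
    contractX l (spinorBasis m S) = 0 := by
  induction S using Finset.induction_on with
  | empty => rw [spinorBasis_empty, contractX_one]
  | insert j S hj ih =>
    rw [Finset.mem_insert, not_or] at h
    obtain ⟨ε, -, hε, hw⟩ := wedgeY_spinorBasis_of_notMem hj
    have h2 : spinorBasis m (insert j S) = ε • wedgeY j (spinorBasis m S) := by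
      rw [hw, smul_smul, hε, one_smul]
    have h3 := LinearMap.congr_fun (contractX_mul_wedgeY l j) (spinorBasis m S)
    rw [if_neg h.1, zero_sub, Module.End.mul_apply, LinearMap.neg_apply, Module.End.mul_apply,
      ih h.2, map_zero, neg_zero] at h3
    rw [h2, map_smul, h3, smul_zero]

/-- The Hermitian product on `Σ_{2m}` for which the monomials are orthonormal. -/
def hermSpinor : Spinor m →ₗ[ℂ] Spinor m →ₗ⋆[ℂ] ℂ :=
  LinearMap.mk₂'ₛₗ (RingHom.id ℂ) (starRingEnd ℂ)
    (fun φ ψ => ∑ S, (spinorBasis m).repr φ S * conj ((spinorBasis m).repr ψ S))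
    (fun φ φ' ψ => by simp [add_mul, Finset.sum_add_distrib])
    (fun c φ ψ => by simp [Finset.mul_sum, mul_assoc])
    (fun φ ψ ψ' => by simp [mul_add, Finset.sum_add_distrib])
    (fun c φ ψ => by simp [Finset.mul_sum, mul_left_comm])

theorem hermSpinor_apply (φ ψ : Spinor m) : hermSpinor φ ψ =
    ∑ S, (spinorBasis m).repr φ S * conj ((spinorBasis m).repr ψ S) := rfl

theorem hermSpinor_conj (φ ψ : Spinor m) : conj (hermSpinor φ ψ) = hermSpinor ψ φ := by
  simp [hermSpinor_apply, mul_comm]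

theorem hermSpinor_basis (S T : Finset (Fin m)) :
    hermSpinor (spinorBasis m S) (spinorBasis m T) = if S = T then 1 else 0 := by
  simp [hermSpinor_apply, Finsupp.single_apply]

theorem hermSpinor_self (φ : Spinor m) : ∃ r : ℝ, hermSpinor φ φ = r ∧ (φ ≠ 0 → 0 < r) := by
  refine ⟨∑ S, Complex.normSq ((spinorBasis m).repr φ S), ?_, fun h => ?_⟩
  · simp [hermSpinor_apply, Complex.mul_conj]
  · obtain ⟨S, hS⟩ : ∃ S, (spinorBasis m).repr φ S ≠ 0 := by
      by_contra! hS
      exact h ((spinorBasis m).repr.map_eq_zero_iff.mp (Finsupp.ext hS))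
    exact Finset.sum_pos' (fun S _ => Complex.normSq_nonneg _)
      ⟨S, Finset.mem_univ _, Complex.normSq_pos.mpr hS⟩

/-- Creation and annihilation operators are adjoint to each other. -/
theorem hermSpinor_wedgeY (l : Fin m) (φ ψ : Spinor m) :
    hermSpinor (wedgeY l φ) ψ = hermSpinor φ (contractX l ψ) := by
  have key : ∀ S T, hermSpinor (wedgeY l (spinorBasis m S)) (spinorBasis m T) =
      hermSpinor (spinorBasis m S) (contractX l (spinorBasis m T)) := by
    intro S T
    have hc : ∀ (U : Finset (Fin m)), l ∉ U → ∃ ε : ℂ, conj ε = ε ∧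
        wedgeY l (spinorBasis m U) = ε • spinorBasis m (insert l U) ∧
        contractX l (spinorBasis m (insert l U)) = ε • spinorBasis m U := by
      intro U hU
      obtain ⟨ε, hε, hε2, hw⟩ := wedgeY_spinorBasis_of_notMem hU
      refine ⟨ε, hε, hw, ?_⟩
      have h3 := LinearMap.congr_fun (contractX_mul_wedgeY l l) (spinorBasis m U)
      rw [if_pos rfl, LinearMap.sub_apply, Module.End.one_apply, Module.End.mul_apply,
        Module.End.mul_apply, contractX_spinorBasis_of_notMem hU, map_zero, sub_zero, hw,
        map_smul] at h3
      rw [← h3, smul_smul, hε2, one_smul]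
    by_cases hT : l ∈ T
    · obtain ⟨U, hU, rfl⟩ : ∃ U, l ∉ U ∧ insert l U = T :=
        ⟨T.erase l, Finset.notMem_erase _ _, Finset.insert_erase hT⟩
      obtain ⟨ε, hε, -, hcU⟩ := hc U hU
      rw [hcU, map_smulₛₗ, hε, hermSpinor_basis]
      by_cases hS : l ∈ S
      · rw [wedgeY_spinorBasis_of_mem hS, map_zero, LinearMap.zero_apply, if_neg, smul_zero]
        rintro rfl
        exact hU hS
      · obtain ⟨ε', -, hw', hcS⟩ := hc S hS
        rw [hw', map_smul, LinearMap.smul_apply, hermSpinor_basis]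
        by_cases hSU : S = U
        · subst hSU
          have : ε' • spinorBasis m S = ε • spinorBasis m S := hcS.symm.trans hcU
          have : ε' = ε := smul_left_injective ℂ ((spinorBasis m).ne_zero S) this
          rw [this, if_pos rfl, if_pos rfl]
        · rw [if_neg hSU, if_neg, smul_zero, smul_zero]
          intro h
          apply hSU
          rw [← Finset.erase_insert hS, h, Finset.erase_insert hU]
    · rw [contractX_spinorBasis_of_notMem hT, map_zero]
      by_cases hS : l ∈ S
      · rw [wedgeY_spinorBasis_of_mem hS, map_zero, LinearMap.zero_apply]
      · obtain ⟨ε', -, hw', -⟩ := hc S hS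
        rw [hw', map_smul, LinearMap.smul_apply, hermSpinor_basis, if_neg, smul_zero]
        rintro rfl
        exact hT (Finset.mem_insert_self _ _)
  rw [← (spinorBasis m).sum_repr φ, ← (spinorBasis m).sum_repr ψ]
  simp only [map_sum, map_smul, map_smulₛₗ, LinearMap.sum_apply, LinearMap.smul_apply, key]

theorem hermSpinor_contractX (l : Fin m) (φ ψ : Spinor m) :
    hermSpinor (contractX l φ) ψ = hermSpinor φ (wedgeY l ψ) := by
  rw [← hermSpinor_conj, ← hermSpinor_wedgeY, hermSpinor_conj]

theorem hermSpinor_transfer (l j : Fin m) (φ ψ : Spinor m) :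
    hermSpinor (transfer l j φ) ψ = hermSpinor φ (transfer j l ψ) := by
  rw [transfer, Module.End.mul_apply, hermSpinor_wedgeY, hermSpinor_contractX]
  rfl

/-! ### Expectation values in the state `y_1^ε ∧ ω^k` -/

/-- If `φ` is an eigenvector of a symmetric operator `K` with real eigenvalue and `O` shifts the
eigenvalues of `K` by `r ≠ 0`, then `O φ` is orthogonal to `φ`. -/
theorem hermSpinor_eq_zero_of_shift {K O : Module.End ℂ (Spinor m)} {φ : Spinor m} {κ : ℝ} {r : ℂ}
    (hK : ∀ φ ψ, hermSpinor (K φ) ψ = hermSpinor φ (K ψ)) (hφ : K φ = (κ : ℂ) • φ)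
    (hKO : K * O = O * K + r • O) (hr : r ≠ 0) : hermSpinor (O φ) φ = 0 := by
  have h1 := hK (O φ) φ
  have h2 := LinearMap.congr_fun hKO φ
  rw [Module.End.mul_apply, LinearMap.add_apply, Module.End.mul_apply, LinearMap.smul_apply, hφ,
    map_smul] at h2
  rw [h2, hφ, map_smulₛₗ, map_add, LinearMap.add_apply, map_smul, map_smul, LinearMap.smul_apply,
    LinearMap.smul_apply, Complex.conj_ofReal, add_eq_left, smul_eq_zero] at h1
  exact h1.resolve_left hr

theorem hermSpinor_sympA (p q : Fin n) (φ ψ : Spinor (2 * n + 1)) :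
    hermSpinor (sympA p q φ) ψ = hermSpinor φ (sympA q p ψ) := by
  simp only [sympA, LinearMap.sub_apply, map_sub, hermSpinor_transfer]

/-- The total degree of a spinor. -/
def degreeOp (n : ℕ) : Module.End ℂ (Spinor (2 * n + 1)) := transfer 0 0 + horDegree n

theorem degreeOp_omegaSpinor (k : ℕ) (ε : Fin 2) :
    degreeOp n (omegaSpinor n k ε) = ((((ε : ℕ) + 2 * k : ℕ) : ℝ) : ℂ) • omegaSpinor n k ε := by
  rw [degreeOp, LinearMap.add_apply, transfer_zero_zero_omegaSpinor, horDegree_omegaSpinor,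
    ← add_smul]
  push_cast
  rfl

theorem degreeOp_eq_sum (n : ℕ) : degreeOp n = ∑ l, transfer l l := by
  rw [sum_index, degreeOp, horDegree]

theorem hermSpinor_degreeOp (φ ψ : Spinor (2 * n + 1)) :
    hermSpinor (degreeOp n φ) ψ = hermSpinor φ (degreeOp n ψ) := by
  simp only [degreeOp_eq_sum, LinearMap.sum_apply, map_sum, hermSpinor_transfer]

theorem degreeOp_mul_wedgeY (l : Fin (2 * n + 1)) :
    degreeOp n * wedgeY l = wedgeY l * degreeOp n + wedgeY l := by
  simp [degreeOp_eq_sum, Finset.sum_mul, Finset.mul_sum, transfer_mul_wedgeY,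
    Finset.sum_add_distrib]

theorem expect_wedgeY_wedgeY (l j : Fin (2 * n + 1)) (k : ℕ) (ε : Fin 2) :
    hermSpinor ((wedgeY l * wedgeY j) (omegaSpinor n k ε)) (omegaSpinor n k ε) = 0 := by
  refine hermSpinor_eq_zero_of_shift hermSpinor_degreeOp (degreeOp_omegaSpinor k ε) (r := 2) ?_
    two_ne_zero
  rw [← mul_assoc, degreeOp_mul_wedgeY, add_mul, mul_assoc, degreeOp_mul_wedgeY, two_smul]
  noncomm_ring

theorem expect_contractX_contractX (l j : Fin (2 * n + 1)) (k : ℕ) (ε : Fin 2) :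
    hermSpinor ((contractX l * contractX j) (omegaSpinor n k ε)) (omegaSpinor n k ε) = 0 := by
  rw [Module.End.mul_apply, hermSpinor_contractX, hermSpinor_contractX, ← hermSpinor_conj,
    ← Module.End.mul_apply, expect_wedgeY_wedgeY, map_zero]

theorem expect_transfer_of_ne {l j : Fin (2 * n + 1)} (h : l ≠ j) (k : ℕ) (ε : Fin 2) :
    hermSpinor (transfer l j (omegaSpinor n k ε)) (omegaSpinor n k ε) = 0 := by
  rcases index_cases l with rfl | ⟨p, rfl⟩ | ⟨p, rfl⟩
  -- `y_l ∧ (x_j ⌟ ·)` shifts the degree in `y_1` if `l` is the index of `y_1`, and the difference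
  -- of the degrees in `y_{2p}` and `y_{2p+1}` if `l` is attached to `p`
  · refine hermSpinor_eq_zero_of_shift (K := transfer 0 0) (κ := (ε : ℕ)) (r := 1)
      (hermSpinor_transfer 0 0) (by simpa using transfer_zero_zero_omegaSpinor k ε) ?_ one_ne_zero
    rw [transfer_mul_transfer, if_pos rfl, if_neg h.symm]
    simp
  · refine hermSpinor_eq_zero_of_shift (K := sympA p p) (κ := 0)
      (r := 1 + if j = sndIdx p then 1 else 0)
      (hermSpinor_sympA p p) (by simpa using sympA_omegaSpinor p p k ε) ?_ ?_
    · rw [sympA, sub_mul, transfer_mul_transfer (fstIdx p) (fstIdx p),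
        transfer_mul_transfer (sndIdx p) (sndIdx p)]
      rcases eq_or_ne j (sndIdx p) with rfl | h1
      · simp [add_smul, mul_sub]
        abel
      · simp [mul_sub, h.symm, h1]
        abel
    · split_ifs <;> norm_num
  · refine hermSpinor_eq_zero_of_shift (K := sympA p p) (κ := 0)
      (r := -1 - if j = fstIdx p then 1 else 0)
      (hermSpinor_sympA p p) (by simpa using sympA_omegaSpinor p p k ε) ?_ ?_
    · rw [sympA, sub_mul, transfer_mul_transfer (fstIdx p) (fstIdx p),
        transfer_mul_transfer (sndIdx p) (sndIdx p)]
      rcases eq_or_ne j (fstIdx p) with rfl | h1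
      · simp [sub_smul, mul_sub]
        abel
      · simp [mul_sub, h.symm, h1]
        abel
    · split_ifs <;> norm_num

theorem expect_transfer_zero (k : ℕ) (ε : Fin 2) :
    hermSpinor (transfer 0 0 (omegaSpinor n k ε)) (omegaSpinor n k ε) =
      ((ε : ℕ) : ℂ) * hermSpinor (omegaSpinor n k ε) (omegaSpinor n k ε) := by
  rw [transfer_zero_zero_omegaSpinor, map_smul, LinearMap.smul_apply, smul_eq_mul]

theorem expect_transfer_snd (p : Fin n) (k : ℕ) (ε : Fin 2) :
    hermSpinor (transfer (sndIdx p) (sndIdx p) (omegaSpinor n k ε)) (omegaSpinor n k ε) =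
      hermSpinor (transfer (fstIdx p) (fstIdx p) (omegaSpinor n k ε)) (omegaSpinor n k ε) := by
  have h := sympA_omegaSpinor p p k ε
  rw [sympA, LinearMap.sub_apply, sub_eq_zero] at h
  rw [h]

/-- The symmetry of `ω` under `𝔰𝔭(2n, ℂ)` makes all the degrees in the `y_{2p}` have the same
expectation. -/
theorem expect_transfer_fst_eq (p q : Fin n) (k : ℕ) (ε : Fin 2) :
    hermSpinor (transfer (fstIdx p) (fstIdx p) (omegaSpinor n k ε)) (omegaSpinor n k ε) =
      hermSpinor (transfer (fstIdx q) (fstIdx q) (omegaSpinor n k ε)) (omegaSpinor n k ε) := by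
  have hO : sympA p q * transfer (fstIdx q) (fstIdx p) =
      transfer (fstIdx q) (fstIdx p) * sympA p q +
        (transfer (fstIdx p) (fstIdx p) - transfer (fstIdx q) (fstIdx q)) := by
    rw [sympA, sub_mul, transfer_mul_transfer, transfer_mul_transfer (sndIdx q)]
    simp [mul_sub]
    abel
  have h1 := hermSpinor_sympA p q (transfer (fstIdx q) (fstIdx p) (omegaSpinor n k ε))
    (omegaSpinor n k ε)
  have h2 := LinearMap.congr_fun hO (omegaSpinor n k ε)
  rw [Module.End.mul_apply, LinearMap.add_apply, Module.End.mul_apply, sympA_omegaSpinor, map_zero,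
    zero_add, LinearMap.sub_apply] at h2
  rw [h2, sympA_omegaSpinor, map_zero, map_sub, LinearMap.sub_apply, sub_eq_zero] at h1
  exact h1

theorem expect_transfer_fst (p : Fin n) (k : ℕ) (ε : Fin 2) :
    hermSpinor (transfer (fstIdx p) (fstIdx p) (omegaSpinor n k ε)) (omegaSpinor n k ε) =
      (k / n : ℂ) * hermSpinor (omegaSpinor n k ε) (omegaSpinor n k ε) := by
  have hn : (n : ℂ) ≠ 0 := Nat.cast_ne_zero.mpr (Fin.pos p).ne'
  have h := congrArg (fun η => hermSpinor η (omegaSpinor n k ε))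
    (horDegree_omegaSpinor (n := n) k ε)
  simp only [horDegree, LinearMap.sum_apply, LinearMap.add_apply, map_sum, map_add,
    expect_transfer_snd, expect_transfer_fst_eq _ p, map_smul, LinearMap.smul_apply,
    Finset.sum_const, Finset.card_univ, Fintype.card_fin, smul_eq_mul, nsmul_eq_mul] at h
  field_simp
  linear_combination h / 2

/-! ### Products of two Clifford multiplications -/

theorem cliffordBasis_zero (l : Fin m) :
    cliffordBasis (l, 0) = Complex.I • (contractX l + wedgeY l) := by simp [cliffordBasis]

theorem cliffordBasis_one (l : Fin m) : cliffordBasis (l, 1) = wedgeY l - contractX l := by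
  simp [cliffordBasis]

theorem wedgeY_mul_contractX (l j : Fin m) : wedgeY l * contractX j = transfer l j := rfl

theorem contractX_mul_wedgeY_eq_transfer (j l : Fin m) :
    contractX j * wedgeY l = (if j = l then 1 else 0) - transfer l j := contractX_mul_wedgeY j l

theorem cliffordBasis_zero_mul_zero (l j : Fin m) : cliffordBasis (l, 0) * cliffordBasis (j, 0) =
    -(contractX l * contractX j + wedgeY l * wedgeY j + (if l = j then 1 else 0)
      - transfer j l + transfer l j) := by
  rw [cliffordBasis_zero, cliffordBasis_zero, smul_mul_smul_comm, Complex.I_mul_I, neg_one_smul,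
    add_mul, mul_add, mul_add, contractX_mul_wedgeY_eq_transfer, wedgeY_mul_contractX]
  abel

theorem cliffordBasis_one_mul_one (l j : Fin m) : cliffordBasis (l, 1) * cliffordBasis (j, 1) =
    contractX l * contractX j + wedgeY l * wedgeY j - (if l = j then 1 else 0)
      + transfer j l - transfer l j := by
  rw [cliffordBasis_one, cliffordBasis_one,
    sub_mul, mul_sub, mul_sub, contractX_mul_wedgeY_eq_transfer, wedgeY_mul_contractX]
  abel

theorem cliffordBasis_zero_mul_one (l j : Fin m) : cliffordBasis (l, 0) * cliffordBasis (j, 1) =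
    Complex.I • (wedgeY l * wedgeY j - contractX l * contractX j + (if l = j then 1 else 0)
      - transfer j l - transfer l j) := by
  rw [cliffordBasis_zero, cliffordBasis_one, smul_mul_assoc,
    add_mul, mul_sub, mul_sub, contractX_mul_wedgeY_eq_transfer, wedgeY_mul_contractX]
  congr 1
  abel

theorem cliffordBasis_one_mul_zero (l j : Fin m) : cliffordBasis (l, 1) * cliffordBasis (j, 0) =
    Complex.I • (wedgeY l * wedgeY j - contractX l * contractX j - (if l = j then 1 else 0)
      + transfer j l + transfer l j) := by
  rw [cliffordBasis_zero, cliffordBasis_one, mul_smul_comm,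
    sub_mul, mul_add, mul_add, contractX_mul_wedgeY_eq_transfer, wedgeY_mul_contractX]
  congr 1
  abel

theorem cliffordBasis_pair (l : Fin m) : cliffordBasis (l, 0) * cliffordBasis (l, 1) =
    Complex.I • (1 - 2 * transfer l l) := by
  rw [cliffordBasis_zero_mul_one, wedgeY_mul_self, contractX_mul_self, if_pos rfl, two_mul]
  congr 1
  abel

theorem cliffordBasis_pair_swap (l : Fin m) : cliffordBasis (l, 1) * cliffordBasis (l, 0) =
    -(Complex.I • (1 - 2 * transfer l l)) := by
  rw [cliffordBasis_one_mul_zero, wedgeY_mul_self, contractX_mul_self, if_pos rfl, two_mul,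
    ← smul_neg]
  congr 1
  abel

theorem eHat12_oneHat : eHat12 oneHat = Complex.I • oneHat := by
  rw [eHat12, cliffordBasis_pair, oneHat, LinearMap.smul_apply, LinearMap.sub_apply,
    Module.End.one_apply, Module.End.mul_apply, transfer_one, map_zero, sub_zero]

theorem eHat12_yHat : eHat12 yHat = (-Complex.I) • yHat := by
  have h := LinearMap.congr_fun (transfer_mul_wedgeY (0 : Fin 1) 0 0) 1
  simp only [Module.End.mul_apply, LinearMap.add_apply, transfer_one, map_zero, zero_add,
    if_true, Module.End.one_apply] at h
  have hy : yHat = wedgeY 0 1 := by rw [yHat, wedgeY_apply, mul_one]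
  rw [eHat12, cliffordBasis_pair, LinearMap.smul_apply, LinearMap.sub_apply,
    Module.End.one_apply, two_mul, LinearMap.add_apply, hy, h, neg_smul, ← smul_neg]
  congr 1
  abel

/-! ### Purity -/

theorem herm_tmul (φ φ' : Spinor m) (v v' : Spinor 1) :
    herm (φ ⊗ₜ[ℂ] v) (φ' ⊗ₜ[ℂ] v') = hermSpinor φ φ' * hermSpinor v v' := by
  rw [herm, Fintype.sum_prod_type, hermSpinor_apply, hermSpinor_apply, Finset.sum_mul_sum]
  refine Finset.sum_congr rfl fun S _ => Finset.sum_congr rfl fun T _ => ?_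
  simp only [Module.Basis.tensorProduct_repr_tmul_apply, smul_eq_mul, map_mul]
  ring

theorem hermSpinor_one : hermSpinor (1 : Spinor m) 1 = 1 := by
  rw [← spinorBasis_empty, hermSpinor_basis, if_pos rfl]

theorem hermSpinor_y (l : Fin m) : hermSpinor (y l) (y l) = 1 := by
  rw [← spinorBasis_singleton, hermSpinor_basis, if_pos rfl]

theorem etaForm_smul_tmul {φ : Spinor m} {v : Spinor 1} {σ : ℝ}
    (hv : eHat12 v = (σ * Complex.I) • v) (hv1 : hermSpinor v v = 1) (c : ℂ) (X Y : E m) :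
    etaForm (c • φ ⊗ₜ[ℂ] v) X Y =
      -(σ * Complex.normSq c * (hermSpinor (wedgeAction X Y φ) φ).im) := by
  have h : conj c * (c * hermSpinor (wedgeAction X Y φ) φ) * (σ * Complex.I * 1) =
      ((σ * Complex.normSq c : ℝ) : ℂ) * (Complex.I * hermSpinor (wedgeAction X Y φ) φ) := by
    push_cast
    rw [← Complex.mul_conj]
    ring
  rw [etaForm, TensorProduct.smul_tmul', TensorProduct.map_tmul, hv, herm_tmul]
  simp only [map_smul, map_smulₛₗ, LinearMap.smul_apply, hv1, smul_eq_mul]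
  rw [h, Complex.re_ofReal_mul, Complex.I_mul_re]
  ring

theorem wedgeAction_eq_sum (X Y : E m) : wedgeAction X Y =
    ∑ q, ∑ r, ((X q * Y r : ℝ) : ℂ) •
      (cliffordBasis q * cliffordBasis r + if q = r then 1 else 0) := by
  have h : (((inner ℝ X Y : ℝ) : ℂ) • 1 : Module.End ℂ (Spinor m)) =
      ∑ q, ∑ r, ((X q * Y r : ℝ) : ℂ) • if q = r then 1 else 0 := by
    simp [PiLp.inner_apply, Finset.sum_smul, mul_comm]
  rw [wedgeAction, h, clifford, clifford, Finset.sum_mul_sum, ← Finset.sum_add_distrib]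
  refine Finset.sum_congr rfl fun q _ => ?_
  rw [← Finset.sum_add_distrib]
  refine Finset.sum_congr rfl fun r _ => ?_
  rw [smul_mul_smul_comm, smul_add, Complex.ofReal_mul]

/-- The expectation of `1 - 2 N_l` in the state `y_1^ε ∧ ω^k`, relative to its squared norm, where
`N_l` is the degree in the variable with index `l`. -/
def expectSign (n k : ℕ) (ε : Fin 2) (l : Fin (2 * n + 1)) : ℝ :=
  if l = 0 then 1 - 2 * (ε : ℕ) else 1 - 2 * (k / n : ℝ)

theorem expect_transfer_self (k : ℕ) (ε : Fin 2) (l : Fin (2 * n + 1)) :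
    hermSpinor ((1 - 2 * transfer l l) (omegaSpinor n k ε)) (omegaSpinor n k ε) =
      expectSign n k ε l * hermSpinor (omegaSpinor n k ε) (omegaSpinor n k ε) := by
  rw [LinearMap.sub_apply, two_mul (transfer l l), LinearMap.add_apply, Module.End.one_apply,
    map_sub, LinearMap.sub_apply, map_add, LinearMap.add_apply]
  rcases index_cases l with rfl | ⟨p, rfl⟩ | ⟨p, rfl⟩
  · rw [expect_transfer_zero, expectSign, if_pos rfl]
    push_cast
    ring
  · rw [expect_transfer_fst, expectSign, if_neg (fstIdx_ne_zero p)]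
    push_cast
    ring
  · rw [expect_transfer_snd, expect_transfer_fst, expectSign, if_neg (sndIdx_ne_zero p)]
    push_cast
    ring

/-- The `2`-form defined by `y_1^ε ∧ ω^k` is diagonal in the basis `e_q`. -/
theorem expect_cliffordBasis_mul (k : ℕ) (ε : Fin 2) (q r : Fin (2 * n + 1) × Fin 2) :
    hermSpinor ((cliffordBasis q * cliffordBasis r + if q = r then 1 else 0)
      (omegaSpinor n k ε)) (omegaSpinor n k ε) =
      if q.1 = r.1 then (((r.2 : ℕ) : ℂ) - ((q.2 : ℕ) : ℂ)) * (Complex.I *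
        (expectSign n k ε q.1 * hermSpinor (omegaSpinor n k ε) (omegaSpinor n k ε))) else 0 := by
  obtain ⟨l, i⟩ := q
  obtain ⟨j, i'⟩ := r
  rcases eq_or_ne l j with rfl | h
  · have hpair := expect_transfer_self (n := n) k ε l
    fin_cases i <;> fin_cases i'
    · simp [cliffordBasis_zero_mul_zero, wedgeY_mul_self, contractX_mul_self, -Module.End.mul_apply]
    · simp [cliffordBasis_pair, -LinearMap.sub_apply, hpair]
    · simp [cliffordBasis_pair_swap, -LinearMap.sub_apply, hpair]
    · simp [cliffordBasis_one_mul_one, wedgeY_mul_self, contractX_mul_self, -Module.End.mul_apply]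
  · have h1 := expect_transfer_of_ne h k ε
    have h2 := expect_transfer_of_ne h.symm k ε
    have h3 := expect_wedgeY_wedgeY l j k ε
    have h4 := expect_contractX_contractX l j k ε
    fin_cases i <;> fin_cases i' <;>
    simp [cliffordBasis_zero_mul_zero, cliffordBasis_zero_mul_one, cliffordBasis_one_mul_zero,
      cliffordBasis_one_mul_one, h, h1, h2, h3, h4, -Module.End.mul_apply]

theorem expect_wedgeAction (k : ℕ) (ε : Fin 2) (X Y : E (2 * n + 1)) :
    hermSpinor (wedgeAction X Y (omegaSpinor n k ε)) (omegaSpinor n k ε) =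
      Complex.I * hermSpinor (omegaSpinor n k ε) (omegaSpinor n k ε) *
        ((∑ l, expectSign n k ε l * (X (l, 0) * Y (l, 1) - X (l, 1) * Y (l, 0)) : ℝ) : ℂ) := by
  have key : hermSpinor (wedgeAction X Y (omegaSpinor n k ε)) (omegaSpinor n k ε) =
      ∑ q, ∑ r, ((X q * Y r : ℝ) : ℂ) * hermSpinor ((cliffordBasis q * cliffordBasis r +
        if q = r then 1 else 0) (omegaSpinor n k ε)) (omegaSpinor n k ε) := by
    rw [wedgeAction_eq_sum, LinearMap.sum_apply, map_sum, LinearMap.sum_apply]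
    refine Finset.sum_congr rfl fun q _ => ?_
    rw [LinearMap.sum_apply, map_sum, LinearMap.sum_apply]
    refine Finset.sum_congr rfl fun r _ => ?_
    rw [LinearMap.smul_apply, map_smul, LinearMap.smul_apply, smul_eq_mul]
  rw [key]
  simp only [expect_cliffordBasis_mul, Fintype.sum_prod_type, Fin.sum_univ_two,
    Complex.ofReal_sum, Finset.mul_sum]
  refine Finset.sum_congr rfl fun l _ => ?_
  rw [Finset.sum_eq_single l, Finset.sum_eq_single l]
  · simp
    ring
  · intro j _ hj
    simp [hj.symm]
  · simp
  · intro j _ hj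
    simp [hj.symm]
  · simp

/-- If the `2`-form of `φ` is diagonal with coefficients `ν l`, then `η̂` is a multiple of a
rotation by a right angle in each plane spanned by `e_{(l,0)}` and `e_{(l,1)}`. -/
theorem etaHat_eq {φ : Spinor m} {v : Spinor 1} {σ ρ : ℝ} {ν : Fin m → ℝ}
    (hv : eHat12 v = (σ * Complex.I) • v) (hv1 : hermSpinor v v = 1)
    (hφ : ∀ X Y, hermSpinor (wedgeAction X Y φ) φ =
      Complex.I * ρ * ((∑ l, ν l * (X (l, 0) * Y (l, 1) - X (l, 1) * Y (l, 0)) : ℝ) : ℂ))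
    (c : ℂ) (X : E m) (l : Fin m) :
    etaHat (c • φ ⊗ₜ[ℂ] v) X (l, 0) = σ * Complex.normSq c * ρ * ν l * X (l, 1) ∧
      etaHat (c • φ ⊗ₜ[ℂ] v) X (l, 1) = -(σ * Complex.normSq c * ρ * ν l * X (l, 0)) := by
  have him : ∀ x : ℝ, (Complex.I * ρ * (x : ℂ)).im = ρ * x := fun x => by
    rw [mul_assoc, ← Complex.ofReal_mul, Complex.I_mul_im, Complex.ofReal_re]
  constructor <;>
  · change etaForm _ _ _ = _
    rw [etaForm_smul_tmul hv hv1, hφ, him, Finset.sum_eq_single l]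
    · simp
      try ring
    · intro j _ hj
      simp [hj]
    · simp

theorem isPure_iff {φ : Spinor m} {v : Spinor 1} {σ ρ : ℝ} {ν : Fin m → ℝ}
    (hv : eHat12 v = (σ * Complex.I) • v) (hv1 : hermSpinor v v = 1) (hσ : σ ^ 2 = 1)
    (hφ : ∀ X Y, hermSpinor (wedgeAction X Y φ) φ =
      Complex.I * ρ * ((∑ l, ν l * (X (l, 0) * Y (l, 1) - X (l, 1) * Y (l, 0)) : ℝ) : ℂ))
    (c : ℂ) :
    IsPure (c • φ ⊗ₜ[ℂ] v) ↔ ∀ l, (Complex.normSq c * ρ * ν l) ^ 2 = 1 := by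
  have h := etaHat_eq hv hv1 hφ c
  constructor
  · intro hp l
    have h1 := congrArg (fun Z : E m => Z (l, 0)) (hp (EuclideanSpace.single (l, 0) 1))
    simp only [(h _ l).1, (h _ l).2, PiLp.neg_apply, PiLp.single_apply, if_true] at h1
    linear_combination -h1 - (Complex.normSq c * ρ * ν l) ^ 2 * hσ
  · intro hl X
    ext ⟨l, i⟩
    have hl := hl l
    fin_cases i
    · change etaHat _ _ (l, 0) = -X (l, 0)
      rw [(h _ l).1, (h _ l).2]
      linear_combination (-X (l, 0) * σ ^ 2) * hl - X (l, 0) * hσ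
    · change etaHat _ _ (l, 1) = -X (l, 1)
      rw [(h _ l).2, (h _ l).1]
      linear_combination (-X (l, 1) * σ ^ 2) * hl - X (l, 1) * hσ

/-- The spinor `1̂` of `Σ_2` for `i = 0` and the spinor `ŷ_1` for `i = 1`. -/
def hatSpinor (i : Fin 2) : Spinor 1 := if i = 0 then oneHat else yHat

theorem eHat12_hatSpinor (i : Fin 2) :
    eHat12 (hatSpinor i) = (((1 - 2 * (i : ℕ) : ℝ) : ℂ) * Complex.I) • hatSpinor i := by
  fin_cases i
  · simp [hatSpinor, eHat12_oneHat]
  · simp [hatSpinor, eHat12_yHat]; norm_num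

theorem hermSpinor_hatSpinor (i : Fin 2) : hermSpinor (hatSpinor i) (hatSpinor i) = 1 := by
  fin_cases i
  · exact hermSpinor_one
  · exact hermSpinor_y 0

theorem sq_one_sub_two_mul_fin_two (i : Fin 2) : (1 - 2 * ((i : ℕ) : ℝ)) ^ 2 = 1 := by
  fin_cases i <;> norm_num

theorem exists_isPure_iff (hn : 1 ≤ n) (k : ℕ) (ε i : Fin 2) :
    (∃ c : ℂ, IsPure (c • omegaSpinor n k ε ⊗ₜ[ℂ] hatSpinor i)) ↔ k = 0 ∨ k = n := by
  obtain ⟨ρ, hρ, hpos⟩ := hermSpinor_self (omegaSpinor n k ε)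
  have hn0 : (n : ℝ) ≠ 0 := by positivity
  have hiff := isPure_iff (eHat12_hatSpinor i) (hermSpinor_hatSpinor i)
    (sq_one_sub_two_mul_fin_two i) (φ := omegaSpinor n k ε) (ρ := ρ) (ν := expectSign n k ε)
    (fun X Y => by rw [expect_wedgeAction, hρ])
  simp_rw [hiff]
  constructor
  · rintro ⟨c, hc⟩
    -- the plane with index `0` forces the normalisation, any other plane then restricts `k`
    have h0 := hc 0
    have h1 := hc (fstIdx ⟨0, hn⟩)
    rw [expectSign, if_pos rfl, mul_pow, sq_one_sub_two_mul_fin_two, mul_one] at h0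
    rw [expectSign, if_neg (fstIdx_ne_zero _), mul_pow, h0, one_mul] at h1
    field_simp at h1
    have h2 : (k : ℝ) * (k - n) = 0 := by linear_combination h1 / 4
    rcases mul_eq_zero.mp h2 with h | h
    · exact Or.inl (Nat.cast_eq_zero.mp h)
    · exact Or.inr (Nat.cast_injective (sub_eq_zero.mp h))
  · intro hk
    have hρ0 := hpos (omegaSpinor_ne_zero (by omega) ε)
    -- this scalar makes the norm of the spinor equal to `1`
    refine ⟨(Real.sqrt ρ⁻¹ : ℝ), fun l => ?_⟩
    rw [Complex.normSq_ofReal, Real.mul_self_sqrt (inv_pos.mpr hρ0).le, inv_mul_cancel₀ hρ0.ne',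
      one_mul, expectSign]
    split_ifs
    · exact sq_one_sub_two_mul_fin_two ε
    · rcases hk with rfl | rfl
      · simp
      · rw [div_self hn0]; norm_num

theorem not_isPure_zero : ¬ IsPure (0 : SpinCSpinor (2 * n + 1)) := by
  intro h
  have h0 : ∀ X, etaHat (0 : SpinCSpinor (2 * n + 1)) X = 0 := fun X => by
    ext q
    simp [etaHat, etaForm, herm]
  have h1 := congrArg (fun Z : E (2 * n + 1) => Z (0, 0)) (h (EuclideanSpace.single (0, 0) 1))
  simp [h0] at h1

/-! ### The isotropy representation -/

@[simp] theorem qi_re : qi.re = 0 := rfl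
@[simp] theorem qi_imI : qi.imI = 1 := rfl
@[simp] theorem qi_imJ : qi.imJ = 0 := rfl
@[simp] theorem qi_imK : qi.imK = 0 := rfl
@[simp] theorem qj_re : qj.re = 0 := rfl
@[simp] theorem qj_imI : qj.imI = 0 := rfl
@[simp] theorem qj_imJ : qj.imJ = 1 := rfl
@[simp] theorem qj_imK : qj.imK = 0 := rfl
@[simp] theorem qk_re : qk.re = 0 := rfl
@[simp] theorem qk_imI : qk.imI = 0 := rfl
@[simp] theorem qk_imJ : qk.imJ = 0 := rfl
@[simp] theorem qk_imK : qk.imK = 1 := rfl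

/-- The horizontal tangent vector with the quaternion `w` in the entry `(p+1, 0)`. -/
def hor (w : ℍ[ℝ]) (p : Fin n) : QMat n :=
  Matrix.single p.succ 0 w - Matrix.single 0 p.succ (star w)

/-- The indices of the two coordinates attached to `p`, in a form uniform in `i = 0, 1`. -/
def siteIdx (i : Fin 2) (p : Fin n) : Fin (2 * n + 1) := if i = 0 then fstIdx p else sndIdx p

/-- The quaternionic units corresponding to the four basis vectors attached to each `p`: up to
scale, the basis vector with index `(siteIdx i p, ε)` is `hor (unitQ i ε) p`. -/
def unitQ : Fin 2 → Fin 2 → ℍ[ℝ] := ![![qj, qk], ![qi, 1]]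

/-- The upper left entries of the two vertical basis vectors, up to scale. -/
def vertQ : Fin 2 → ℍ[ℝ] := ![-qk, qj]

theorem symF_eq_hor {u : ℍ[ℝ]} (hu : star u = -u) (p : Fin n) : symF u p = hor u p := by
  rw [symF, hor, hu, ← Matrix.single_neg, sub_neg_eq_add, add_comm]

theorem frame_siteIdx (a t : ℝ) (i ε : Fin 2) (p : Fin n) :
    frame n a t (siteIdx i p, ε) = (Real.sqrt (2 * a))⁻¹ • hor (unitQ i ε) p := by
  have h0 : siteIdx i p ≠ 0 := by rw [siteIdx]; split_ifs <;> simp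
  rw [frame, if_neg h0]
  congr 1
  have h2 : (2 * (p : ℕ) + 1) / 2 = p := by omega
  have h3 : (2 * (p : ℕ)) / 2 = p := by omega
  fin_cases i <;> fin_cases ε <;>
    simp [siteIdx, fstIdx, sndIdx, frame₀, unitQ, h2, h3, Nat.add_mod]
  · exact symF_eq_hor (by ext <;> simp) p
  · exact symF_eq_hor (by ext <;> simp) p
  · exact symF_eq_hor (by ext <;> simp) p
  · simp [skewE, hor]

theorem frame_zero (a t : ℝ) (ε : Fin 2) :
    frame n a t (0, ε) = (Real.sqrt (2 * t * a))⁻¹ • Matrix.single 0 0 (vertQ ε) := by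
  rw [frame, if_pos rfl]
  congr 1
  fin_cases ε <;> rfl

theorem vert_smul (c : ℝ) (Y : QMat n) : vert (c • Y) = c • vert Y := by
  rw [vert, vert, Matrix.smul_single, Matrix.smul_apply]

theorem metric_smul_smul (a t c d : ℝ) (Y Z : QMat n) :
    metric a t (c • Y) (d • Z) = c * d * metric a t Y Z := by
  simp only [metric, B0, vert_smul, ← smul_sub, Matrix.smul_mul, Matrix.mul_smul,
    Matrix.trace_smul, Quaternion.re_smul, smul_eq_mul]
  ring

theorem isotropyRep_of_frame {a t c d : ℝ} {Y Z X : QMat n} {q r : Fin (2 * n + 1) × Fin 2}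
    (hq : frame n a t q = c • Y) (hr : frame n a t r = d • Z) :
    isotropyRep n a t X q r = d * c * metric a t ⁅X, Z⁆ Y := by
  have hlie : ⁅X, d • Z⁆ = d • ⁅X, Z⁆ := by
    rw [Ring.lie_def, Ring.lie_def, Matrix.mul_smul, Matrix.smul_mul, smul_sub]
  rw [isotropyRep, Matrix.of_apply, hq, hr, hlie, metric_smul_smul]

theorem B0_single (Z : QMat n) (i j : Fin (n + 1)) (u : ℍ[ℝ]) :
    B0 Z (Matrix.single i j u) = -(Z j i * u).re := by
  rw [B0, Matrix.trace_mul_single]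
  rfl

theorem B0_sub (Z Y Y' : QMat n) : B0 Z (Y - Y') = B0 Z Y - B0 Z Y' := by
  rw [B0, mul_sub, Matrix.trace_sub, Quaternion.re_sub, neg_sub, B0, B0]
  ring

theorem B0_zero (Z : QMat n) : B0 Z 0 = 0 := by simp [B0]

theorem metric_hor (a t : ℝ) (Z : QMat n) (v : ℍ[ℝ]) (r : Fin n) :
    metric a t Z (hor v r) = a * ((Z r.succ 0 * star v).re - (Z 0 r.succ * v).re) := by
  have hv : vert (hor v r) = 0 := by
    simp [vert, hor]
  rw [metric, hv, sub_zero, B0_zero, hor, B0_sub, B0_single, B0_single]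
  have h1 : vert Z 0 r.succ = 0 :=
    Matrix.single_apply_of_ne _ _ _ _ _ (by simp [eq_comm])
  have h2 : vert Z r.succ 0 = 0 :=
    Matrix.single_apply_of_ne _ _ _ _ _ (by simp [eq_comm])
  rw [Matrix.sub_apply, Matrix.sub_apply, h1, h2, sub_zero, sub_zero]
  ring

theorem metric_single_zero (a t : ℝ) (Z : QMat n) (v : ℍ[ℝ]) :
    metric a t Z (Matrix.single 0 0 v) = -(2 * a * t * (Z 0 0 * v).re) := by
  have hv : vert (Matrix.single 0 0 v : QMat n) = Matrix.single 0 0 v := by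
    simp [vert]
  rw [metric, hv, sub_self, B0_zero, B0_single, vert, Matrix.single_apply_same]
  ring

theorem mul_single_apply' (Y : QMat n) (i j c d : Fin (n + 1)) (u : ℍ[ℝ]) :
    (Y * Matrix.single i j u) c d = if d = j then Y c i * u else 0 := by
  split_ifs with h
  · rw [h, Matrix.mul_single_apply_same]
  · rw [Matrix.mul_single_apply_of_ne _ _ _ _ _ h]

theorem single_mul_apply' (Y : QMat n) (i j c d : Fin (n + 1)) (u : ℍ[ℝ]) :
    (Matrix.single i j u * Y) c d = if c = i then u * Y j d else 0 := by
  split_ifs with h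
  · rw [h, Matrix.single_mul_apply_same]
  · rw [Matrix.single_mul_apply_of_ne _ _ _ _ _ h]

theorem isotropy_swap {X : QMat n} (hX : X ∈ isotropyAlgebra n) (i j : Fin (n + 1)) :
    star (X i j) = -X j i := by
  have h := congrFun (congrFun hX.1 j) i
  rwa [Matrix.conjTranspose_apply, Matrix.neg_apply] at h

theorem isotropy_zero_zero {X : QMat n} (hX : X ∈ isotropyAlgebra n) :
    X 0 0 = (X 0 0).imI • qi := by
  have h := congrArg QuaternionAlgebra.re (isotropy_swap hX 0 0)
  rw [Quaternion.re_star, Quaternion.re_neg] at h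
  have h0 : (X 0 0).re = 0 := by linarith
  ext <;> simp [h0, hX.2.2.1, hX.2.2.2]

theorem lie_hor_apply (X : QMat n) (w : ℍ[ℝ]) (p : Fin n) (c d : Fin (n + 1)) :
    ⁅X, hor w p⁆ c d =
      ((if d = 0 then X c p.succ * w else 0) - if d = p.succ then X c 0 * star w else 0) -
      ((if c = p.succ then w * X 0 d else 0) - if c = 0 then star w * X p.succ d else 0) := by
  rw [Ring.lie_def, Matrix.sub_apply, hor, mul_sub, sub_mul, Matrix.sub_apply, Matrix.sub_apply,
    mul_single_apply', mul_single_apply', single_mul_apply', single_mul_apply']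

theorem lie_hor_zero_zero {X : QMat n} (hX : X ∈ isotropyAlgebra n) (w : ℍ[ℝ]) (p : Fin n) :
    ⁅X, hor w p⁆ 0 0 = 0 := by
  have h := hX.2.1 p
  rw [lie_hor_apply]
  simp [h.1, h.2, eq_comm]

theorem lie_hor_succ_zero {X : QMat n} (w : ℍ[ℝ]) (p r : Fin n) :
    ⁅X, hor w p⁆ r.succ 0 = X r.succ p.succ * w - if r = p then w * X 0 0 else 0 := by
  rw [lie_hor_apply]
  simp [Fin.succ_ne_zero, (Fin.succ_ne_zero _).symm]

/-- The bracket of two skew-Hermitian matrices is skew-Hermitian. -/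
theorem lie_hor_zero_succ {X : QMat n} (hX : X ∈ isotropyAlgebra n) (w : ℍ[ℝ]) (p r : Fin n) :
    ⁅X, hor w p⁆ 0 r.succ = -star (⁅X, hor w p⁆ r.succ 0) := by
  rw [lie_hor_succ_zero, star_sub, star_mul, isotropy_swap hX, apply_ite star, star_mul,
    isotropy_swap hX, lie_hor_apply]
  simp [Fin.succ_ne_zero, (Fin.succ_ne_zero _).symm]
  split_ifs <;> simp

theorem lie_vert_apply {X : QMat n} (hX : X ∈ isotropyAlgebra n) (u : ℍ[ℝ]) (i j : Fin (n + 1)) :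
    ⁅X, (Matrix.single 0 0 u : QMat n)⁆ i j =
      if i = 0 ∧ j = 0 then X 0 0 * u - u * X 0 0 else 0 := by
  rw [Ring.lie_def, Matrix.sub_apply, mul_single_apply', single_mul_apply']
  induction i using Fin.cases with
  | zero =>
    induction j using Fin.cases with
    | zero => simp
    | succ r => simp [(hX.2.1 r).1]
  | succ p => simp [(hX.2.1 p).2]

/-- The horizontal block of the isotropy representation of `(x i, M)` is `w ↦ M w - w x i`. -/
theorem isotropyRep_hor {a t : ℝ} (ha : 0 < a) {X : QMat n} (hX : X ∈ isotropyAlgebra n)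
    (i j ε ε' : Fin 2) (r p : Fin n) :
    isotropyRep n a t X (siteIdx i r, ε) (siteIdx j p, ε') =
      ((X r.succ p.succ * unitQ j ε' - if r = p then unitQ j ε' * X 0 0 else 0) *
        star (unitQ i ε)).re := by
  have h2 : (Real.sqrt (2 * a))⁻¹ * (Real.sqrt (2 * a))⁻¹ * (2 * a) = 1 := by
    rw [← mul_inv, Real.mul_self_sqrt (by positivity), inv_mul_cancel₀ (by positivity)]
  rw [isotropyRep_of_frame (frame_siteIdx a t i ε r) (frame_siteIdx a t j ε' p), metric_hor,
    lie_hor_zero_succ hX, ← lie_hor_succ_zero]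
  generalize ⁅X, hor (unitQ j ε') p⁆ r.succ 0 = z
  have h3 : (-star z * unitQ i ε).re = -(z * star (unitQ i ε)).re := by
    simp
  rw [h3]
  linear_combination (z * star (unitQ i ε)).re * h2

/-- The vertical block of the isotropy representation is the adjoint action of the upper left
entry. -/
theorem isotropyRep_vert {a t : ℝ} (ha : 0 < a) (ht : 0 < t) {X : QMat n}
    (hX : X ∈ isotropyAlgebra n) (ε ε' : Fin 2) :
    isotropyRep n a t X (0, ε) (0, ε') =
      -((X 0 0 * vertQ ε' - vertQ ε' * X 0 0) * vertQ ε).re := by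
  have h2 : (Real.sqrt (2 * t * a))⁻¹ * (Real.sqrt (2 * t * a))⁻¹ * (2 * a * t) = 1 := by
    rw [← mul_inv, Real.mul_self_sqrt (by positivity), mul_right_comm 2 a t,
      inv_mul_cancel₀ (by positivity)]
  rw [isotropyRep_of_frame (frame_zero a t ε) (frame_zero a t ε'), metric_single_zero,
    lie_vert_apply hX, if_pos ⟨rfl, rfl⟩]
  linear_combination -((X 0 0 * vertQ ε' - vertQ ε' * X 0 0) * vertQ ε).re * h2

theorem isotropyRep_vert_hor {a t : ℝ} {X : QMat n} (hX : X ∈ isotropyAlgebra n)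
    (ε j ε' : Fin 2) (p : Fin n) : isotropyRep n a t X (0, ε) (siteIdx j p, ε') = 0 := by
  rw [isotropyRep_of_frame (frame_zero a t ε) (frame_siteIdx a t j ε' p), metric_single_zero,
    lie_hor_zero_zero hX]
  simp

theorem isotropyRep_hor_vert {a t : ℝ} {X : QMat n} (hX : X ∈ isotropyAlgebra n)
    (ε j ε' : Fin 2) (p : Fin n) : isotropyRep n a t X (siteIdx j p, ε') (0, ε) = 0 := by
  rw [isotropyRep_of_frame (frame_siteIdx a t j ε' p) (frame_zero a t ε), metric_hor,
    lie_vert_apply hX, lie_vert_apply hX]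
  simp

/-! ### The spin lift of the isotropy representation -/

theorem sum_siteIdx {M : Type*} [AddCommMonoid M] (f : Fin (2 * n + 1) × Fin 2 → M) :
    ∑ q, f q = ∑ ε, f (0, ε) + ∑ p : Fin n, ∑ i, ∑ ε, f (siteIdx i p, ε) := by
  rw [Fintype.sum_prod_type, sum_index]
  simp [siteIdx]

/-- The spin lift of a matrix which preserves the vertical and the horizontal space. -/
theorem spinLift_eq_blocks {A : Matrix (Fin (2 * n + 1) × Fin 2) (Fin (2 * n + 1) × Fin 2) ℝ}
    (h1 : ∀ ε j ε' p, A (0, ε) (siteIdx j p, ε') = 0)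
    (h2 : ∀ ε j ε' p, A (siteIdx j p, ε') (0, ε) = 0) :
    spinLift A = (1 / 4 : ℂ) •
      (∑ ε, ∑ ε', ((A (0, ε) (0, ε') : ℝ) : ℂ) • (cliffordBasis (0, ε') * cliffordBasis (0, ε)) +
      ∑ r : Fin n, ∑ p : Fin n, ∑ i, ∑ ε, ∑ j, ∑ ε',
        ((A (siteIdx i r, ε) (siteIdx j p, ε') : ℝ) : ℂ) •
          (cliffordBasis (siteIdx j p, ε') * cliffordBasis (siteIdx i r, ε))) := by
  rw [spinLift, sum_siteIdx]
  congr 2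
  · refine Finset.sum_congr rfl fun ε _ => ?_
    rw [sum_siteIdx]
    simp [h1]
  · refine Finset.sum_congr rfl fun r _ => ?_
    simp only [sum_siteIdx, h2, Complex.ofReal_zero, zero_smul, Finset.sum_const_zero, zero_add]
    simp only [Fin.sum_univ_two, Finset.sum_add_distrib]

/-- The spin lift of left multiplication by the quaternion `M` and right multiplication by `-x i`
between the horizontal coordinates attached to `p` and `r`. All terms of the form `y ∧ y' ∧` and
`x ⌟ x' ⌟` cancel. -/
theorem spinLift_hor_block (M : ℍ[ℝ]) (x : ℝ) (r p : Fin n) :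
    ∑ i, ∑ ε, ∑ j, ∑ ε', ((((M * unitQ j ε' - if r = p then unitQ j ε' * (x • qi) else 0) *
        star (unitQ i ε)).re : ℝ) : ℂ) •
          (cliffordBasis (siteIdx j p, ε') * cliffordBasis (siteIdx i r, ε)) =
    (2 * M.re : ℂ) • (sympA r p - sympA p r - if r = p then (2 : ℂ) • 1 else 0)
    - (2 * M.imI * Complex.I : ℂ) • (sympA r p + sympA p r)
    + (2 * M.imJ * Complex.I : ℂ) • (sympB r p + sympC r p)
    + (2 * M.imK : ℂ) • (sympB r p - sympC r p)
    + if r = p then (4 * x * Complex.I : ℂ) •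
      (1 - (transfer (fstIdx p) (fstIdx p) + transfer (sndIdx p) (sndIdx p))) else 0 := by
  simp only [Fin.sum_univ_two]
  simp [siteIdx, unitQ, cliffordBasis_zero_mul_zero, cliffordBasis_zero_mul_one,
    cliffordBasis_one_mul_zero, cliffordBasis_one_mul_one, -Module.End.mul_apply]
  rcases eq_or_ne r p with rfl | h
  · simp [sympA, sympB, sympC, wedgeY_mul_self, contractX_mul_self]
    module
  · simp [sympA, sympB, sympC, h, h.symm]
    module

theorem spinLift_vert_block {a t : ℝ} (ha : 0 < a) (ht : 0 < t) {X : QMat n}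
    (hX : X ∈ isotropyAlgebra n) :
    ∑ ε, ∑ ε', ((isotropyRep n a t X (0, ε) (0, ε') : ℝ) : ℂ) •
        (cliffordBasis (0, ε') * cliffordBasis (0, ε) : Module.End ℂ (Spinor (2 * n + 1))) =
      (4 * (X 0 0).imI * Complex.I : ℂ) • (1 - 2 * transfer 0 0) := by
  have hx := isotropy_zero_zero hX
  generalize (X 0 0).imI = x at hx ⊢
  simp only [isotropyRep_vert ha ht hX, hx, Fin.sum_univ_two, cliffordBasis_pair,
    cliffordBasis_pair_swap]
  simp [vertQ]
  module

/-- The isotropy algebra acts on `y_1^ε ∧ ω^k` through its part `𝔲(1)`, as `𝔰𝔭(n)` preserves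
`ω`. -/
theorem spinLift_isotropyRep_omegaSpinor {a t : ℝ} (ha : 0 < a) (ht : 0 < t) {X : QMat n}
    (hX : X ∈ isotropyAlgebra n) (k : ℕ) (ε : Fin 2) :
    spinLift (isotropyRep n a t X) (omegaSpinor n k ε) =
      ((X 0 0).imI * Complex.I * (n + 1 - 2 * k - 2 * (ε : ℕ)) : ℂ) • omegaSpinor n k ε := by
  have hre : ∀ i, (X i i).re = 0 := fun i => by
    have h := congrArg QuaternionAlgebra.re (isotropy_swap hX i i)
    rw [Quaternion.re_star, Quaternion.re_neg] at h
    linarith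
  have hN := horDegree_omegaSpinor (n := n) k ε
  rw [horDegree, LinearMap.sum_apply] at hN
  rw [spinLift_eq_blocks (fun ε j ε' p => isotropyRep_vert_hor hX ε j ε' p)
    (fun ε j ε' p => isotropyRep_hor_vert hX ε j ε' p), spinLift_vert_block ha ht hX]
  simp only [isotropyRep_hor ha hX]
  have hx := isotropy_zero_zero hX
  generalize (X 0 0).imI = x at hx ⊢
  simp only [hx, spinLift_hor_block]
  have hblock : ∀ r p : Fin n,
      ((2 * (X r.succ p.succ).re : ℂ) • (sympA r p - sympA p r - if r = p then (2 : ℂ) • 1 else 0)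
      - (2 * (X r.succ p.succ).imI * Complex.I : ℂ) • (sympA r p + sympA p r)
      + (2 * (X r.succ p.succ).imJ * Complex.I : ℂ) • (sympB r p + sympC r p)
      + (2 * (X r.succ p.succ).imK : ℂ) • (sympB r p - sympC r p)
      + if r = p then (4 * x * Complex.I : ℂ) • (1 - (transfer (fstIdx p) (fstIdx p) +
        transfer (sndIdx p) (sndIdx p))) else 0 : Module.End ℂ (Spinor (2 * n + 1)))
        (omegaSpinor n k ε) =
      if r = p then (4 * x * Complex.I : ℂ) • (omegaSpinor n k ε -
        (transfer (fstIdx p) (fstIdx p) + transfer (sndIdx p) (sndIdx p)) (omegaSpinor n k ε))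
      else 0 := fun r p => by
    rcases eq_or_ne r p with rfl | h
    · simp [sympA_omegaSpinor, sympB_omegaSpinor, sympC_omegaSpinor, hre]
    · simp [sympA_omegaSpinor, sympB_omegaSpinor, sympC_omegaSpinor, h]
  rw [LinearMap.smul_apply, LinearMap.add_apply, LinearMap.sum_apply]
  simp only [LinearMap.sum_apply, hblock, Finset.sum_ite_eq, Finset.mem_univ, if_true]
  rw [← Finset.smul_sum, Finset.sum_sub_distrib, hN, LinearMap.smul_apply, LinearMap.sub_apply,
    two_mul (transfer 0 0), LinearMap.add_apply, transfer_zero_zero_omegaSpinor,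
    Module.End.one_apply, Finset.sum_const, Finset.card_univ, Fintype.card_fin]
  module

/-! ### Invariance -/

theorem isotropyAction_omegaSpinor {a t : ℝ} (ha : 0 < a) (ht : 0 < t) {X : QMat n}
    (hX : X ∈ isotropyAlgebra n) (s' : ℤ) (k : ℕ) (ε i : Fin 2) :
    isotropyAction n a t (2 * s') X (omegaSpinor n k ε ⊗ₜ[ℂ] hatSpinor i) =
      ((X 0 0).imI * Complex.I * (n + 1 - 2 * k - 2 * (ε : ℕ) + s' * (1 - 2 * (i : ℕ))) : ℂ) •
        omegaSpinor n k ε ⊗ₜ[ℂ] hatSpinor i := by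
  rw [isotropyAction, LinearMap.add_apply, TensorProduct.map_tmul, TensorProduct.map_tmul,
    spinLift_isotropyRep_omegaSpinor ha ht hX, LinearMap.smul_apply, eHat12_hatSpinor,
    Module.End.one_apply, Module.End.one_apply, smul_smul, TensorProduct.tmul_smul,
    ← TensorProduct.smul_tmul', ← add_smul]
  congr 1
  push_cast
  ring

/-- The infinitesimal generator of the factor `U(1)` of the isotropy group. -/
theorem single_qi_mem_isotropyAlgebra (n : ℕ) :
    (Matrix.single 0 0 qi : QMat n) ∈ isotropyAlgebra n := by
  refine ⟨?_, fun p => ⟨?_, ?_⟩, ?_, ?_⟩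
  · have h : star qi = -qi := by ext <;> simp
    rw [Matrix.conjTranspose_single, h, Matrix.single_neg]
  · exact Matrix.single_apply_of_ne _ _ _ _ _ (by simp [eq_comm])
  · exact Matrix.single_apply_of_ne _ _ _ _ _ (by simp [eq_comm])
  · simp
  · simp

/-- As the isotropy algebra acts on a nonzero spinor of the family by a character, the generator of
`U(1)` alone decides whether the spinor is invariant. -/
theorem isInvariantSpinor_iff {a t : ℝ} (ha : 0 < a) (ht : 0 < t) (s' : ℤ) (k : ℕ) (ε i : Fin 2)
    {c : ℂ} (h : c • omegaSpinor n k ε ⊗ₜ[ℂ] hatSpinor i ≠ 0) :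
    IsInvariantSpinor n a t (2 * s') (c • omegaSpinor n k ε ⊗ₜ[ℂ] hatSpinor i) ↔
      (n : ℤ) + 1 - 2 * k - 2 * (ε : ℕ) + s' * (1 - 2 * (i : ℕ)) = 0 := by
  constructor
  · intro hinv
    have h1 := hinv _ (single_qi_mem_isotropyAlgebra n)
    rw [map_smul, isotropyAction_omegaSpinor ha ht (single_qi_mem_isotropyAlgebra n),
      smul_comm, smul_eq_zero] at h1
    have h2 := h1.resolve_right h
    rw [Matrix.single_apply_same, qi_imI, Complex.ofReal_one, one_mul] at h2
    exact_mod_cast (mul_eq_zero.mp h2).resolve_left Complex.I_ne_zero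
  · intro hs X hX
    rw [map_smul, isotropyAction_omegaSpinor ha ht hX]
    have h2 : (n + 1 - 2 * k - 2 * (ε : ℕ) + s' * (1 - 2 * (i : ℕ)) : ℂ) = 0 := by
      exact_mod_cast congrArg (Int.cast : ℤ → ℂ) hs
    rw [h2, mul_zero, zero_smul, smul_zero]

/-- The sufficiency of the condition on `s'`, including the case where the spinor vanishes. -/
theorem isInvariantSpinor_of_eq {a t : ℝ} (ha : 0 < a) (ht : 0 < t) {s' : ℤ} {k : ℕ} {ε i : Fin 2}
    (c : ℂ) (hs : (n : ℤ) + 1 - 2 * k - 2 * (ε : ℕ) + s' * (1 - 2 * (i : ℕ)) = 0) :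
    IsInvariantSpinor n a t (2 * s') (c • omegaSpinor n k ε ⊗ₜ[ℂ] hatSpinor i) := by
  by_cases h : c • omegaSpinor n k ε ⊗ₜ[ℂ] hatSpinor i = 0
  · intro X _
    rw [h, map_zero]
  · exact (isInvariantSpinor_iff ha ht s' k ε i h).mpr hs

theorem mem_four_iff (k : ℕ) (ψ : SpinCSpinor (2 * n + 1)) :
    ψ ∈ ({(omega n ^ k) ⊗ₜ[ℂ] oneHat, (y1 n * omega n ^ k) ⊗ₜ[ℂ] oneHat,
        (omega n ^ k) ⊗ₜ[ℂ] yHat, (y1 n * omega n ^ k) ⊗ₜ[ℂ] yHat} :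
        Set (SpinCSpinor (2 * n + 1))) ↔
      ∃ ε i : Fin 2, ψ = omegaSpinor n k ε ⊗ₜ[ℂ] hatSpinor i := by
  simp only [Fin.exists_fin_two, omegaSpinor_zero, omegaSpinor_one, hatSpinor, if_true,
    one_ne_zero, if_false, Set.mem_insert_iff, Set.mem_singleton_iff]
  tauto

end SpinCProjective

open SpinCProjective in
theorem mainTheorem12 (n : ℕ) (hn : 1 ≤ n) (a t : ℝ) (ha : 0 < a) (ht : 0 < t) :
    -- the four spinors are invariant, for the structures with `s = 2s'` and the indicated `s'`
    (∀ k : ℕ,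
      SpinCProjective.IsInvariantSpinor n a t (2 * (2 * (k : ℤ) - n - 1))
        ((SpinCProjective.omega n ^ k) ⊗ₜ[ℂ] SpinCProjective.oneHat) ∧
      SpinCProjective.IsInvariantSpinor n a t (2 * (2 * (k : ℤ) - n + 1))
        ((SpinCProjective.y1 n * SpinCProjective.omega n ^ k) ⊗ₜ[ℂ] SpinCProjective.oneHat) ∧
      SpinCProjective.IsInvariantSpinor n a t (2 * ((n : ℤ) + 1 - 2 * k))
        ((SpinCProjective.omega n ^ k) ⊗ₜ[ℂ] SpinCProjective.yHat) ∧
      SpinCProjective.IsInvariantSpinor n a t (2 * ((n : ℤ) - 1 - 2 * k))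
        ((SpinCProjective.y1 n * SpinCProjective.omega n ^ k) ⊗ₜ[ℂ] SpinCProjective.yHat)) ∧
    -- a scalar multiple of any of them is pure if and only if `k = 0` or `k = n`
    (∀ k : ℕ, ∀ ψ ∈ ({(SpinCProjective.omega n ^ k) ⊗ₜ[ℂ] SpinCProjective.oneHat,
        (SpinCProjective.y1 n * SpinCProjective.omega n ^ k) ⊗ₜ[ℂ] SpinCProjective.oneHat,
        (SpinCProjective.omega n ^ k) ⊗ₜ[ℂ] SpinCProjective.yHat,
        (SpinCProjective.y1 n * SpinCProjective.omega n ^ k) ⊗ₜ[ℂ] SpinCProjective.yHat} :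
          Set (SpinCProjective.SpinCSpinor (2 * n + 1))),
      (∃ c : ℂ, SpinCProjective.IsPure (c • ψ)) ↔ k = 0 ∨ k = n) ∧
    -- the structures for which one of them is invariant and, up to a scalar multiple, pure
    (∀ s' : ℤ,
      (∃ k : ℕ, ∃ ψ ∈ ({(SpinCProjective.omega n ^ k) ⊗ₜ[ℂ] SpinCProjective.oneHat,
          (SpinCProjective.y1 n * SpinCProjective.omega n ^ k) ⊗ₜ[ℂ] SpinCProjective.oneHat,
          (SpinCProjective.omega n ^ k) ⊗ₜ[ℂ] SpinCProjective.yHat,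
          (SpinCProjective.y1 n * SpinCProjective.omega n ^ k) ⊗ₜ[ℂ] SpinCProjective.yHat} :
            Set (SpinCProjective.SpinCSpinor (2 * n + 1))),
        ∃ c : ℂ, SpinCProjective.IsInvariantSpinor n a t (2 * s') (c • ψ) ∧
          SpinCProjective.IsPure (c • ψ)) ↔
      s' = (n : ℤ) + 1 ∨ s' = -((n : ℤ) + 1) ∨ s' = (n : ℤ) - 1 ∨ s' = -((n : ℤ) - 1)) := by
  have four : ∀ k : ℕ, ∀ {s' : ℤ} {ε i : Fin 2},
      (n : ℤ) + 1 - 2 * k - 2 * (ε : ℕ) + s' * (1 - 2 * (i : ℕ)) = 0 →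
      IsInvariantSpinor n a t (2 * s') (omegaSpinor n k ε ⊗ₜ[ℂ] hatSpinor i) :=
    fun k _ _ _ hs => by simpa using isInvariantSpinor_of_eq ha ht 1 hs
  refine ⟨fun k => ⟨?_, ?_, ?_, ?_⟩, fun k ψ hψ => ?_, fun s' => ⟨?_, fun hs => ?_⟩⟩
  · simpa [omegaSpinor_zero, hatSpinor] using four k (ε := 0) (i := 0) (s' := 2 * k - n - 1)
      (by simp; ring)
  · simpa [omegaSpinor_one, hatSpinor] using four k (ε := 1) (i := 0) (s' := 2 * k - n + 1)
      (by simp; ring)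
  · simpa [omegaSpinor_zero, hatSpinor] using four k (ε := 0) (i := 1) (s' := n + 1 - 2 * k)
      (by simp)
  · simpa [omegaSpinor_one, hatSpinor] using four k (ε := 1) (i := 1) (s' := n - 1 - 2 * k)
      (by simp; ring)
  · obtain ⟨ε, i, rfl⟩ := (mem_four_iff k ψ).mp hψ
    exact exists_isPure_iff hn k ε i
  · rintro ⟨k, ψ, hψ, c, hinv, hpure⟩
    obtain ⟨ε, i, rfl⟩ := (mem_four_iff k ψ).mp hψ
    -- purity excludes the zero spinor, for which invariance would not determine `s'`
    have h0 : c • omegaSpinor n k ε ⊗ₜ[ℂ] hatSpinor i ≠ 0 := fun h =>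
      not_isPure_zero (n := n) (h ▸ hpure)
    have hs := (isInvariantSpinor_iff ha ht s' k ε i h0).mp hinv
    have hk := (exists_isPure_iff hn k ε i).mp ⟨c, hpure⟩
    fin_cases ε <;> fin_cases i <;> simp at hs <;> omega
  -- the case `k = 0` already realises all four values of `s'`
  · have hex : ∀ ε i : Fin 2, (n : ℤ) + 1 - 2 * (ε : ℕ) + s' * (1 - 2 * (i : ℕ)) = 0 →
        ∃ k : ℕ, ∃ ψ ∈ ({(omega n ^ k) ⊗ₜ[ℂ] oneHat, (y1 n * omega n ^ k) ⊗ₜ[ℂ] oneHat,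
          (omega n ^ k) ⊗ₜ[ℂ] yHat, (y1 n * omega n ^ k) ⊗ₜ[ℂ] yHat} :
          Set (SpinCSpinor (2 * n + 1))),
          ∃ c : ℂ, IsInvariantSpinor n a t (2 * s') (c • ψ) ∧ IsPure (c • ψ) := by
      intro ε i h
      obtain ⟨c, hc⟩ := (exists_isPure_iff hn 0 ε i).mpr (Or.inl rfl)
      exact ⟨0, _, (mem_four_iff 0 _).mpr ⟨ε, i, rfl⟩, c,
        isInvariantSpinor_of_eq ha ht c (by simpa using h), hc⟩
    rcases hs with rfl | rfl | rfl | rfl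
    · exact hex 0 1 (by simp)
    · exact hex 0 0 (by simp)
    · exact hex 1 1 (by simp; ring)
    · exact hex 1 0 (by simp; ring)

end
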